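/- Let $\mathbb{K}\in\{\mathbb{R},\mathbb{C}\}$. Equip $\mathbb{K}[t]$ with the involution $*$ given by coefficientwise complex conjugation and $t^*=t$ (trivial if $\mathbb{K}=\mathbb{R}$), extend it to $\mathbb{K}(t)$, and write $A^*$ for the entrywise conjugate of the transpose of a matrix $A$. Let $n\ge 0$ and let $M\in\mathrm{Mat}_n(\mathbb{K}[t])$ be hermitian ($M^*=M$) and positive semidefinite, i.e. $M(x)$ is positive semidefinite for every $x\in\mathbb{R}$. Let $k$ be the rank of $M$. Let $d=\det(M)$ if $\det(M)\neq 0$; if $\det (M)=0$, let $d$ be a greatest common divisor of the $k\times k$ minors of $M$. Put $$\mathcal{O}_M=\Big\{\tfrac{a}{b}\in\mathbb{K}(t)\;:\; a,b\in\mathbb{K}[t],\ b\ne 0,\ b\text{ coprime to }d\Big\}.$$ A monic Smith normal form of $M$ is a diagonal matrix $D=\langle a_1,\dots,a_k,0,\dots,0\rangle$ with monic polynomials $a_1\mid a_2\mid\dots\mid a_k$ in $\mathbb{K}[t]$ such that $PMT=D$ for some matrices $P,T$ invertible in $\mathrm{Mat}_n(\mathbb{K}[t])$. **Theorem.** $M$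 has a unique monic Smith normal form $D$, and $M$ and $D$ are congruent over $\mathcal{O}_M$: there is a matrix $S$ invertible in $\mathrm{Mat}_n(\mathcal{O}_M)$ such that $M=S^*DS$. -/

import Mathlib

open Polynomial

/-- Coefficientwise conjugation on `K[t]`, with `t* = t`. -/
noncomputable instance polyStarRing {K : Type*} [CommRing K] [StarRing K] : StarRing K[X] where
  star p := p.map (starRingEnd K)
  star_involutive p := by
    show (p.map (starRingEnd K)).map (starRingEnd K) = p
    ext i
    simp
  star_mul p q := by
    show (p * q).map (starRingEnd K) = q.map (starRingEnd K) * p.map (starRingEnd K)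
    rw [Polynomial.map_mul, mul_comm]
  star_add p q := by
    show (p + q).map (starRingEnd K) = p.map (starRingEnd K) + q.map (starRingEnd K)
    rw [Polynomial.map_add]

theorem polyConj_injective {K : Type*} [Field K] [StarRing K] :
    Function.Injective (starRingEnd K[X]) :=
  star_injective

/-- The involution of `K(t)` induced by that of `K[t]`, as a ring homomorphism. -/
noncomputable def ratFuncConj {K : Type*} [Field K] [StarRing K] : RatFunc K →+* RatFunc K :=
  IsFractionRing.map (polyConj_injective (K := K))

theorem ratFuncConj_div {K : Type*} [Field K] [StarRing K] (a b : K[X]) :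
    ratFuncConj (algebraMap K[X] (RatFunc K) a / algebraMap K[X] (RatFunc K) b) =
      algebraMap K[X] (RatFunc K) (star a) / algebraMap K[X] (RatFunc K) (star b) := by
  unfold ratFuncConj IsFractionRing.map
  rw [map_div₀, IsLocalization.map_eq, IsLocalization.map_eq]
  rfl

/-- The involution `(a / b)* = a* / b*` of `K(t)`. -/
noncomputable instance ratFuncStarRing {K : Type*} [Field K] [StarRing K] :
    StarRing (RatFunc K) where
  star f := ratFuncConj f
  star_involutive f := by
    show ratFuncConj (ratFuncConj f) = f
    rw [← RatFunc.num_div_denom f, ratFuncConj_div, ratFuncConj_div, star_star, star_star]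
  star_mul f g := by
    show ratFuncConj (f * g) = ratFuncConj g * ratFuncConj f
    rw [map_mul, mul_comm]
  star_add f g := by
    show ratFuncConj (f + g) = ratFuncConj f + ratFuncConj g
    rw [map_add]

section
variable {K : Type*} [Field K]

/-- The ring of all fractions `a / b` in `K(t)` whose denominator `b` is coprime to `d`. -/
noncomputable def fractionsCoprimeTo (d : K[X]) : Subring (RatFunc K) where
  carrier := {f | ∃ a b : K[X], b ≠ 0 ∧ IsCoprime b d ∧
    f = algebraMap K[X] (RatFunc K) a / algebraMap K[X] (RatFunc K) b}
  mul_mem' := by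
    rintro _ _ ⟨a, b, hb, hbd, rfl⟩ ⟨a', b', hb', hbd', rfl⟩
    refine ⟨a * a', b * b', mul_ne_zero hb hb', hbd.mul_left hbd', ?_⟩
    rw [map_mul, map_mul, div_mul_div_comm]
  one_mem' := ⟨1, 1, one_ne_zero, isCoprime_one_left, by simp⟩
  add_mem' := by
    rintro _ _ ⟨a, b, hb, hbd, rfl⟩ ⟨a', b', hb', hbd', rfl⟩
    refine ⟨a * b' + b * a', b * b', mul_ne_zero hb hb', hbd.mul_left hbd', ?_⟩
    rw [div_add_div _ _ (RatFunc.algebraMap_ne_zero hb) (RatFunc.algebraMap_ne_zero hb')]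
    simp only [map_mul, map_add]
  zero_mem' := ⟨0, 1, one_ne_zero, isCoprime_one_left, by simp⟩
  neg_mem' := by
    rintro _ ⟨a, b, hb, hbd, rfl⟩
    exact ⟨-a, b, hb, hbd, by rw [map_neg, neg_div]⟩

open Classical in
/-- The polynomial `d` attached to `M`: it is `det M` if `M` is non-degenerate. Otherwise it is a
greatest common divisor of the minors of `M` of size `r = rank M`. (Choosing indices with
repetition or in another order only adds zero minors and sign changes.) -/
noncomputable def reducedDet {n : ℕ} (M : Matrix (Fin n) (Fin n) K[X]) : K[X] :=
  if M.det ≠ 0 then M.det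
  else Submodule.IsPrincipal.generator (Ideal.span
    (Set.range fun p : (Fin M.rank → Fin n) × (Fin M.rank → Fin n) =>
      (M.submatrix p.1 p.2).det))

/-- The ring `𝒪_M ⊆ K(t)`. -/
noncomputable def localRingOf {n : ℕ} (M : Matrix (Fin n) (Fin n) K[X]) : Subring (RatFunc K) :=
  fractionsCoprimeTo (reducedDet M)

/-- `D = ⟨a₁, …, a_k, 0, …, 0⟩`, `k = rank M`, is the monic Smith normal form of `M` over `K[t]`. -/
def IsMonicSmithNormalForm {n : ℕ} (M D : Matrix (Fin n) (Fin n) K[X]) : Prop :=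
  ∃ a : Fin n → K[X], D = Matrix.diagonal a ∧
    (∀ i : Fin n, (i : ℕ) < M.rank → (a i).Monic) ∧
    (∀ i : Fin n, M.rank ≤ (i : ℕ) → a i = 0) ∧
    (∀ i j : Fin n, i ≤ j → a i ∣ a j) ∧
    ∃ S T : Matrix (Fin n) (Fin n) K[X], IsUnit S ∧ IsUnit T ∧ S * M * T = D

/-- `M` and `N` are congruent over the subring `O` of `K(t)`: `M = S* N S` for some matrix `S`
with entries in `O` that is invertible over `O`. -/
def CongruentOver [StarRing K] {n : ℕ} (O : Subring (RatFunc K))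
    (M N : Matrix (Fin n) (Fin n) K[X]) : Prop :=
  ∃ S : Matrix (Fin n) (Fin n) O, IsUnit S ∧
    M.map (algebraMap K[X] (RatFunc K)) =
      (S.map O.subtype).conjTranspose * N.map (algebraMap K[X] (RatFunc K)) * S.map O.subtype

end

open scoped ComplexOrder in
/-- A matrix over `𝕜[t]`, `𝕜 = ℝ` or `ℂ`, is positive semidefinite if it is hermitian and its
value at every real point is a positive semidefinite matrix. -/
def IsPosSemidefPoly {𝕜 : Type*} [RCLike 𝕜] {n : ℕ} (M : Matrix (Fin n) (Fin n) 𝕜[X]) : Prop :=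
  M.IsHermitian ∧ ∀ x : ℝ, (M.map (Polynomial.eval (x : 𝕜))).PosSemidef

/-!
A positive semidefinite hermitian matrix over `𝕜[t]` is congruent to its monic Smith normal form
over a ring of fractions of `𝕜[t]`. The statement holds for the fractions with denominators coprime
to any fixed `d ≠ 0`, so `d` may be enlarged to a real polynomial divisible by all invariant
factors, by `reducedDet M` and by `t`. All computations take place in `𝕜[t]`: congruence over the
ring of fractions is expressed by `S* M S = c c* N` with `det S` and `c` coprime to `d`
(`CongruentAwayFrom`).

*Smith normal form.* Existence is Gaussian elimination with a pivot of least degree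
(`exists_smith_diagonal`). For uniqueness, the product of the first `k` invariant factors divides
all minors of size `k`, a property that is preserved under equivalence
(`prod_castLE_dvd_of_mul_diagonal_mul`). As a hermitian `M` is equivalent to the conjugate of its
normal form, the invariant factors `a i` are real polynomials.

*Diagonalization.* If `M = a N` with `a` real and no common real factor left in `N`, then
`v* N v` is coprime to `d` for some `v`, by polarization modulo each prime factor of `d` and the
Chinese remainder theorem. Such a `v` splits off orthogonally, and `M` becomes
`⟨b 0, b 1, …⟩` with real polynomials `b i`
(`exists_conjTranspose_mul_mul_eq_diagonal`). Comparing leading products of the `a i` and the `b i`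
turns this into `⟨u 0 a 0, u 1 a 1, …⟩` with `u i` coprime to `d`. Since `u i a i ≥ 0` on the real
line and `a i`, `u i` are coprime, both factors are nonnegative there.

*Removing the units.* A form `⟨u a, v b⟩` is congruent to `⟨a, u v b⟩` as soon as
`u X² + v a b Y² = Z²` has a solution in `ℝ[t]` with `Z` coprime to `d`. For nonnegative
coefficients, Legendre's descent gives some solution (`exists_conic_solution`), and a reflection
moves it to one with `Z` coprime to `d` (`exists_conic_solution_isCoprime`). So all `u i` can be
collected in the last entry, where their product is a hermitian norm `γ γ*` up to a factor `σ σ*`,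
because `M` and its normal form have determinants that differ by a constant only. This treats
`ℝ` and `ℂ` simultaneously, since only real polynomials occur on the diagonals.

*Singular forms.* If `P M T = D` is the normal form, `T* M T` is the orthogonal sum of a
nonsingular form and a zero form (`IsMonicSmithNormalForm.congruentAwayFrom`).
-/

/-! ### Square roots of real polynomials modulo a polynomial -/

/-- Over a complex root `α` of an irreducible real polynomial `π` every complex number is the value
of a real polynomial, unless `α` is real; so `q` is a square modulo `π` unless `q(α) < 0`. -/
theorem exists_sq_sub_dvd_of_irreducible {π q : ℝ[X]} (hπ : Irreducible π)
    (hq : ∀ x, π.eval x = 0 → 0 ≤ q.eval x) : ∃ r, π ∣ r ^ 2 - q := by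
  have hdeg : 0 < π.degree := degree_pos_of_irreducible hπ
  obtain ⟨α, hα⟩ : ∃ α : ℂ, aeval α π = 0 :=
    IsAlgClosed.exists_aeval_eq_zero ℂ π hdeg.ne'
  have key : ∀ r : ℝ[X], aeval α (r ^ 2 - q) = 0 → π ∣ r ^ 2 - q := by
    intro r hr
    have h1 := minpoly.dvd ℝ α hr
    rw [← minpoly.eq_of_irreducible hπ hα] at h1
    exact (dvd_mul_right _ _).trans h1
  by_cases him : α.im = 0
  · have hα' : α = (α.re : ℂ) := Complex.ext rfl (by simp [him])
    have e : ∀ f : ℝ[X], aeval α f = ((f.eval α.re : ℝ) : ℂ) := by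
      intro f
      rw [hα', Complex.ofReal_re]
      exact aeval_algebraMap_apply_eq_algebraMap_eval α.re f
    have h0 : π.eval α.re = 0 := by
      have := e π
      rw [hα] at this
      exact_mod_cast this.symm
    refine ⟨C (Real.sqrt (q.eval α.re)), key _ ?_⟩
    rw [e]
    simp [Real.sq_sqrt (hq _ h0)]
  · obtain ⟨w, hw⟩ := IsAlgClosed.exists_pow_nat_eq (aeval α q) (n := 2) two_pos
    refine ⟨C (w.re - w.im / α.im * α.re) + C (w.im / α.im) * X, key _ ?_⟩
    have : aeval α (C (w.re - w.im / α.im * α.re) + C (w.im / α.im) * X : ℝ[X]) = w := by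
      simp only [map_add, map_mul, aeval_C, aeval_X]
      apply Complex.ext
      · simp
      · simp [him]
    rw [map_sub, map_pow, this, hw, sub_self]

/-- Two solutions of a polynomial congruence modulo coprime moduli can be merged. -/
theorem exists_merge_of_isCoprime {R : Type*} [CommRing R] {x y : R} (h : IsCoprime x y) (r s : R) :
    ∃ t, x ∣ t - r ∧ y ∣ t - s := by
  obtain ⟨a, b, hab⟩ := h
  refine ⟨b * y * r + a * x * s, ⟨a * (s - r), ?_⟩, ⟨b * (r - s), ?_⟩⟩
  · linear_combination -r * hab + 2 * r * hab - r * hab + r * hab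
  · linear_combination s * hab

theorem dvd_sq_sub_of_dvd_sub {R : Type*} [CommRing R] {x r t q : R} (h : x ∣ t - r)
    (hr : x ∣ r ^ 2 - q) : x ∣ t ^ 2 - q := by
  have : t ^ 2 - q = (t - r) * (t + r) + (r ^ 2 - q) := by ring
  rw [this]
  exact dvd_add (h.mul_right _) hr

theorem exists_sq_sub_dvd_of_squarefree {p q : ℝ[X]} (hp : Squarefree p)
    (hq : ∀ x, p.eval x = 0 → 0 ≤ q.eval x) : ∃ r, p ∣ r ^ 2 - q := by
  induction p using UniqueFactorizationMonoid.induction_on_coprime with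
  | h0 => exact absurd hp not_squarefree_zero
  | h1 h => exact ⟨0, h.dvd⟩
  | @hpr π i hπ =>
    rcases Nat.lt_or_ge i 2 with hi | hi
    · interval_cases i
      · exact ⟨0, by simp⟩
      · rw [pow_one] at hq ⊢
        exact exists_sq_sub_dvd_of_irreducible hπ.irreducible hq
    · exact absurd (hp π (by rw [← sq]; exact pow_dvd_pow _ hi)) hπ.not_isUnit
  | @hcp x y hxy hx hy =>
    obtain ⟨r, hr⟩ := hx (hp.squarefree_of_dvd (dvd_mul_right _ _))
      fun t ht => hq t (by simp [ht])
    obtain ⟨s, hs⟩ := hy (hp.squarefree_of_dvd (dvd_mul_left _ _))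
      fun t ht => hq t (by simp [ht])
    obtain ⟨t, htr, hts⟩ := exists_merge_of_isCoprime hxy.isCoprime r s
    exact ⟨t, hxy.isCoprime.mul_dvd (dvd_sq_sub_of_dvd_sub htr hr) (dvd_sq_sub_of_dvd_sub hts hs)⟩

/-- A unit `p` modulo `G` which is nonnegative at the real roots of `G` has an inverse square root
modulo `G`: modulo primes this follows from `exists_sq_sub_dvd_of_irreducible`, and Newton's
iteration lifts the solution to prime powers. -/
theorem exists_sq_mul_sub_one_dvd {G p : ℝ[X]} (hG : G ≠ 0) (hpG : IsCoprime p G)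
    (hp : ∀ x, G.eval x = 0 → 0 ≤ p.eval x) : ∃ s, G ∣ s ^ 2 * p - 1 := by
  induction G using UniqueFactorizationMonoid.induction_on_coprime with
  | h0 => exact absurd rfl hG
  | h1 h => exact ⟨0, h.dvd⟩
  | @hpr π i hπ =>
    induction i with
    | zero => exact ⟨0, by simp⟩
    | succ i ih =>
      have hpπ : IsCoprime p π := hpG.of_isCoprime_of_dvd_right (dvd_pow_self _ i.succ_ne_zero)
      rcases Nat.eq_zero_or_pos i with rfl | hi
      · obtain ⟨r, c, hc⟩ := exists_sq_sub_dvd_of_irreducible (q := p) hπ.irreducible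
          fun x hx => hp x (by simp [hx])
        obtain ⟨a, b, hab⟩ := hpπ
        -- `a` is an inverse of `p` modulo `π`, and `r` is a square root of `p`
        refine ⟨r * a, c * a ^ 2 * p - b * (a * p + 1), ?_⟩
        linear_combination (a ^ 2 * p) * hc + (a * p + 1) * hab
      · obtain ⟨s, c, hc⟩ := ih (pow_ne_zero _ hπ.ne_zero) hpπ.pow_right
          fun x hx => hp x (by
            rw [eval_pow] at hx ⊢
            rw [pow_succ, hx, zero_mul])
        have h2 : (2 : ℝ[X]) * C (1 / 2) = 1 := by
          rw [show (2 : ℝ[X]) = C 2 from rfl, ← C_mul]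
          norm_num
        obtain ⟨j, rfl⟩ : ∃ j, i = j + 1 := ⟨i - 1, by omega⟩
        refine ⟨s * (1 - C (1 / 2) * (π ^ (j + 1) * c)), π ^ j * c ^ 2 *
          (-1 + C (1 / 2) ^ 2 + C (1 / 2) ^ 2 * (π ^ (j + 1) * c)), ?_⟩
        set h := (C (1 / 2) : ℝ[X])
        set ε := π ^ (j + 1) * c
        have hπε : π ^ (j + 1 + 1) * (π ^ j * c ^ 2 * (-1 + h ^ 2 + h ^ 2 * ε)) =
            ε ^ 2 * (-1 + h ^ 2 + h ^ 2 * ε) := by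
          simp only [ε]
          ring
        rw [hπε]
        linear_combination (1 - h * ε) ^ 2 * hc - (ε + ε ^ 2) * h2
  | @hcp x y hxy hx hy =>
    have hne := mul_ne_zero_iff.1 hG
    obtain ⟨r, hr⟩ := hx hne.1 (hpG.of_isCoprime_of_dvd_right (dvd_mul_right _ _))
      fun t ht => hp t (by simp [ht])
    obtain ⟨s, hs⟩ := hy hne.2 (hpG.of_isCoprime_of_dvd_right (dvd_mul_left _ _))
      fun t ht => hp t (by simp [ht])
    obtain ⟨t, htr, hts⟩ := exists_merge_of_isCoprime hxy.isCoprime r s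
    have key : ∀ {z u : ℝ[X]}, z ∣ t - u → z ∣ u ^ 2 * p - 1 → z ∣ t ^ 2 * p - 1 := by
      intro z u h1 h2
      have : t ^ 2 * p - 1 = (t - u) * ((t + u) * p) + (u ^ 2 * p - 1) := by ring
      rw [this]
      exact dvd_add (h1.mul_right _) h2
    exact ⟨t, hxy.isCoprime.mul_dvd (key htr hr) (key hts hs)⟩

/-! ### Conics over the real polynomials -/

/-- Legendre's descent: the conic `p X² + q Y² = Z²` has a nonzero solution in `ℝ[t]` provided that
`p` and `q` are never negative simultaneously. If `p` has the larger degree and is squarefree, then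
`r² - q = p p'` with `deg p' < deg p`, and a solution for `(p', q)` gives one for `(p, q)` by
multiplicativity of the norm form `Z² - q Y²`. -/
theorem exists_conic_solution : ∀ (N : ℕ) (p q : ℝ[X]), p.natDegree + q.natDegree ≤ N → p ≠ 0 →
    q ≠ 0 → (∀ x, ¬(p.eval x < 0 ∧ q.eval x < 0)) →
    ∃ x y z : ℝ[X], (x ≠ 0 ∨ y ≠ 0 ∨ z ≠ 0) ∧ p * x ^ 2 + q * y ^ 2 = z ^ 2 := by
  intro N
  induction N using Nat.strong_induction_on with
  | _ N ih =>
  intro p q hN hp hq hsign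
  wlog hdeg : q.natDegree ≤ p.natDegree generalizing p q
  · obtain ⟨x, y, z, hne, h⟩ := this q p (by omega) hq hp (fun x hx => hsign x hx.symm)
      (by omega)
    exact ⟨y, x, z, by tauto, by rw [← h]; ring⟩
  by_cases hp0 : p.natDegree = 0
  · -- both coefficients are constants, one of which is positive
    obtain ⟨a, rfl⟩ := natDegree_eq_zero.1 hp0
    obtain ⟨b, rfl⟩ := natDegree_eq_zero.1 (by omega : q.natDegree = 0)
    have hs := hsign 0
    simp only [eval_C] at hs
    rcases le_or_gt 0 a with ha | ha
    · refine ⟨1, 0, C (Real.sqrt a), Or.inl one_ne_zero, ?_⟩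
      rw [← C_pow, Real.sq_sqrt ha]
      simp
    · refine ⟨0, 1, C (Real.sqrt b), Or.inr (Or.inl one_ne_zero), ?_⟩
      rw [← C_pow, Real.sq_sqrt (by by_contra hb; exact hs ⟨ha, not_le.1 hb⟩)]
      simp
  by_cases hsq : Squarefree p
  · -- a real root of `p` at which `q < 0` would be a change of sign of `p`
    obtain ⟨r₀, hr₀⟩ := exists_sq_sub_dvd_of_squarefree (q := q) hsq (by
      intro x hx
      by_contra hqx
      rw [not_le] at hqx
      obtain ⟨p₁, rfl⟩ := dvd_iff_isRoot.2 hx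
      have hp₁ : p₁.eval x ≠ 0 := by
        intro h
        obtain ⟨p₂, rfl⟩ := dvd_iff_isRoot.2 h
        exact not_isUnit_X_sub_C x (hsq _ (by rw [← mul_assoc]; exact dvd_mul_right _ _))
      have hqev : ∀ᶠ t in nhds x, q.eval t < 0 :=
        q.continuous.continuousAt.eventually_lt continuousAt_const hqx
      rcases lt_or_gt_of_ne hp₁ with h | h
      · have hev : ∀ᶠ t in nhds x, p₁.eval t < 0 :=
          p₁.continuous.continuousAt.eventually_lt continuousAt_const h
        obtain ⟨t, ht, htx⟩ := ((hqev.and hev).filter_mono (nhdsWithin_le_nhds (s := Set.Ioi x))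
          |>.and self_mem_nhdsWithin).exists
        refine hsign t ⟨?_, ht.1⟩
        simp only [eval_mul, eval_sub, eval_X, eval_C]
        exact mul_neg_of_pos_of_neg (sub_pos.2 htx) ht.2
      · have hev : ∀ᶠ t in nhds x, 0 < p₁.eval t :=
          continuousAt_const.eventually_lt p₁.continuous.continuousAt h
        obtain ⟨t, ht, htx⟩ := ((hqev.and hev).filter_mono (nhdsWithin_le_nhds (s := Set.Iio x))
          |>.and self_mem_nhdsWithin).exists
        refine hsign t ⟨?_, ht.1⟩
        simp only [eval_mul, eval_sub, eval_X, eval_C]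
        exact mul_neg_of_neg_of_pos (sub_neg.2 htx) ht.2)
    -- reduce the square root modulo `p`
    set r := r₀ % p
    have hr : p ∣ r ^ 2 - q := by
      refine dvd_sq_sub_of_dvd_sub ⟨-(r₀ / p), ?_⟩ hr₀
      linear_combination EuclideanDomain.mod_add_div r₀ p
    have hrdeg : r.natDegree < p.natDegree := natDegree_mod_lt _ hp0
    obtain ⟨p', hp'⟩ := hr
    by_cases hp'0 : p' = 0
    · refine ⟨0, 1, r, Or.inr (Or.inl one_ne_zero), ?_⟩
      rw [hp'0] at hp'
      linear_combination -hp'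
    have hp'deg : p'.natDegree < p.natDegree := by
      have h1 : (r ^ 2 - q).natDegree = p.natDegree + p'.natDegree := by
        rw [hp', natDegree_mul hp hp'0]
      have h2 : (r ^ 2 - q).natDegree ≤ max (2 * r.natDegree) q.natDegree :=
        (natDegree_sub_le _ _).trans (max_le_max natDegree_pow_le le_rfl)
      omega
    obtain ⟨x, y, z, hne, h⟩ := ih (p'.natDegree + q.natDegree) (by omega) p' q le_rfl hp'0 hq (by
      rintro x ⟨h1, h2⟩
      have h3 : r.eval x ^ 2 - q.eval x = p.eval x * p'.eval x := by
        rw [← eval_mul, ← hp']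
        simp
      refine hsign x ⟨?_, h2⟩
      by_contra h4
      nlinarith [mul_nonneg (not_lt.1 h4) (neg_nonneg.2 h1.le), sq_nonneg (r.eval x)])
    by_cases hx : x = 0
    · exact ⟨0, y, z, by tauto, by rw [← h, hx]; ring⟩
    · refine ⟨p' * x, r * y + z, r * z + q * y, Or.inl (mul_ne_zero hp'0 hx), ?_⟩
      linear_combination (r ^ 2 - q) * h - p' * x ^ 2 * hp'
  · -- a square factor of `p` can be moved into `x`
    rw [squarefree_iff_no_irreducibles hp] at hsq
    push Not at hsq
    obtain ⟨s, hs, p', rfl⟩ := hsq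
    have hs0 := hs.ne_zero
    have hp'0 : p' ≠ 0 := right_ne_zero_of_mul hp
    have hsdeg : 0 < s.natDegree := hs.natDegree_pos
    rw [natDegree_mul (mul_ne_zero hs0 hs0) hp'0, natDegree_mul hs0 hs0] at hN
    obtain ⟨x, y, z, hne, h⟩ := ih (p'.natDegree + q.natDegree) (by omega) p' q le_rfl hp'0 hq (by
      rintro x ⟨h1, h2⟩
      have hev : ∀ᶠ t in nhds x, p'.eval t < 0 ∧ q.eval t < 0 :=
        (p'.continuous.continuousAt.eventually_lt continuousAt_const h1).and
          (q.continuous.continuousAt.eventually_lt continuousAt_const h2)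
      have hfin : {t | s.eval t = 0}.Finite := by
        refine s.roots.toFinset.finite_toSet.subset fun t ht => ?_
        simpa [hs0] using ht
      have hfin' : ∀ᶠ t in nhdsWithin x {x}ᶜ, s.eval t ≠ 0 :=
        nhdsNE_le_cofinite x hfin.compl_mem_cofinite
      obtain ⟨t, ht, hts⟩ := ((hev.filter_mono nhdsWithin_le_nhds).and hfin').exists
      refine hsign t ⟨?_, ht.2⟩
      simp only [eval_mul]
      exact mul_neg_of_pos_of_neg (mul_self_pos.2 hts) ht.1)
    rcases eq_or_ne x 0 with rfl | hx
    · exact ⟨0, y, z, by tauto, by rw [← h]; ring⟩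
    · exact ⟨x, s * y, s * z, Or.inl hx, by linear_combination s ^ 2 * h⟩

/-- The `d`-primary part of a nonzero polynomial can be split off. -/
theorem exists_primary_decomp {K : Type*} [Field K] (d : K[X]) : ∀ (N : ℕ) (g : K[X]), g ≠ 0 →
    g.natDegree ≤ N → ∃ g₁ g₂ : K[X], ∃ m : ℕ, g = g₁ * g₂ ∧ g₁ ∣ d ^ m ∧ IsCoprime g₂ d := by
  intro N
  induction N using Nat.strong_induction_on with
  | _ N ih =>
  intro g hg hN
  by_cases hc : IsCoprime g d
  · exact ⟨1, g, 0, by simp, by simp, hc⟩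
  · rw [← isRelPrime_iff_isCoprime, IsRelPrime] at hc
    push Not at hc
    obtain ⟨h, ⟨g', rfl⟩, hd, hu⟩ := hc
    have h0 : h ≠ 0 := left_ne_zero_of_mul hg
    have hg' : g' ≠ 0 := right_ne_zero_of_mul hg
    have hdeg : 0 < h.natDegree := by
      rw [Nat.pos_iff_ne_zero]
      intro h1
      exact hu (isUnit_iff_degree_eq_zero.2 (by rw [degree_eq_natDegree h0, h1]; rfl))
    rw [natDegree_mul h0 hg'] at hN
    obtain ⟨g₁, g₂, m, rfl, h1, h2⟩ := ih g'.natDegree (by omega) g' hg' le_rfl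
    exact ⟨h * g₁, g₂, m + 1, by ring, by rw [pow_succ, mul_comm]; exact mul_dvd_mul h1 hd, h2⟩

theorem eq_zero_of_eval_eq_zero {p : ℝ[X]} (h : ∀ x, p.eval x = 0) : p = 0 :=
  Polynomial.funext fun x => by rw [h x, eval_zero]

/-- If `p` and `q` are nonnegative on the real line and `p` is coprime to `d`, the conic
`p X² + q Y² = Z²` has a solution with `Z` coprime to `d`. It is found by reflecting an arbitrary
solution `(x, y, z)` in the quadratic space `⟨p, q⟩`: its image under the reflection along
`(x / z + s, y / z)`, where `s` is an approximate inverse square root of `p` at the primes dividing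
`d`, is close to `(-s, 0)` at these primes. -/
theorem exists_conic_solution_isCoprime {p q d : ℝ[X]} (hp0 : p ≠ 0) (hq0 : q ≠ 0) (hd0 : d ≠ 0)
    (hpd : IsCoprime p d) (hp : ∀ x, 0 ≤ p.eval x) (hq : ∀ x, 0 ≤ q.eval x) :
    ∃ x y z : ℝ[X], IsCoprime z d ∧ p * x ^ 2 + q * y ^ 2 = z ^ 2 := by
  obtain ⟨x, y, z, hne, h⟩ := exists_conic_solution _ p q le_rfl hp0 hq0
    fun t ht => (hp t).not_gt ht.1
  have hz : z ≠ 0 := by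
    rintro rfl
    have h1 : ∀ t, (p * x ^ 2).eval t = 0 ∧ (q * y ^ 2).eval t = 0 := by
      intro t
      have h2 := congrArg (eval t) h
      simp only [eval_add, eval_mul, eval_pow, eval_zero] at h2 ⊢
      have := mul_nonneg (hp t) (sq_nonneg (x.eval t))
      have := mul_nonneg (hq t) (sq_nonneg (y.eval t))
      constructor <;> linarith
    have hx := eq_zero_of_eval_eq_zero fun t => (h1 t).1
    have hy := eq_zero_of_eval_eq_zero fun t => (h1 t).2
    simp [hp0, hq0] at hx hy
    tauto
  by_cases hy : y = 0
  · -- then `p` is a square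
    have hx : x ≠ 0 := by
      rintro rfl
      rw [hy] at h
      exact hz (by simpa using h.symm)
    have h1 : x ∣ z := (IsIntegrallyClosed.pow_dvd_pow_iff two_ne_zero).1 ⟨p, by rw [← h, hy]; ring⟩
    obtain ⟨w, rfl⟩ := h1
    have h2 : p = w ^ 2 := by
      refine mul_right_cancel₀ (pow_ne_zero 2 hx) ?_
      rw [hy] at h
      linear_combination h
    refine ⟨1, 0, w, ?_, by rw [h2]; ring⟩
    rw [h2] at hpd
    exact (IsCoprime.pow_left_iff two_pos).1 hpd
  obtain ⟨g₁, g₂, m, hg, hg₁, hg₂⟩ := exists_primary_decomp d _ (q * y ^ 2)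
    (mul_ne_zero hq0 (pow_ne_zero 2 hy)) le_rfl
  have hg₁0 : g₁ ≠ 0 := fun h0 => mul_ne_zero hq0 (pow_ne_zero 2 hy) (by rw [hg, h0, zero_mul])
  obtain ⟨s, k, hk⟩ := exists_sq_mul_sub_one_dvd (mul_ne_zero hg₁0 hd0)
    ((hpd.pow_right.of_isCoprime_of_dvd_right hg₁).mul_right hpd) fun t _ => hp t
  set η := d * k with hη
  -- With `ε = s² p - 1 = g₁ η`, the vector `w = (x + s z, y)` has `p w₁² + q w₂² = z c`, and the
  -- reflection along `w` maps `(x, y) / z` to `(-s, 0) + (ε / c) w`. The conjugate factor `c'`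
  -- shows that `ε / c = η c' / u`, where `u ≡ 4 g₂` modulo `d`.
  set c := 2 * z + 2 * p * s * x + g₁ * η * z
  set c' := 2 * z - 2 * p * s * x + g₁ * η * z
  set u := 4 * g₂ + 4 * (g₁ * η) * g₂ + η * (g₁ * η) * z ^ 2 with hu
  have hε : s ^ 2 * p = 1 + g₁ * η := by linear_combination hk
  have hcc : c * c' = g₁ * u := by
    simp only [c, c', u]
    linear_combination -4 * (1 + g₁ * η) * h - 4 * p * x ^ 2 * hε + 4 * (1 + g₁ * η) * hg
  refine ⟨-(s * u) + η * c' * (x + s * z), η * c' * y, u, ?_, ?_⟩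
  · have h4 : IsCoprime (4 * g₂) d := by
      refine (isCoprime_mul_unit_left_left ?_ _ _).2 hg₂
      rw [show (4 : ℝ[X]) = C 4 from rfl]
      exact isUnit_C.2 (by norm_num)
    have : u = 4 * g₂ + d * (k * (4 * g₁ * g₂ + (g₁ * η) * z ^ 2)) := by
      rw [hu, hη]
      ring
    rw [this]
    exact h4.add_mul_left_left _
  · have hQ : p * (x + s * z) ^ 2 + q * y ^ 2 = z * c := by
      simp only [c]
      linear_combination h + z ^ 2 * hε
    have hc : 2 * p * s * (x + s * z) = c + g₁ * η * z := by
      simp only [c]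
      linear_combination 2 * z * hε
    linear_combination u ^ 2 * hε + η ^ 2 * c' ^ 2 * hQ - u * η * c' * hc +
      (η ^ 2 * c' * z - u * η) * hcc

/-! ### Minors and divisor chains -/

section minors
variable {R : Type*} [CommRing R] {n k : ℕ}

theorem dvd_minors_mul_left {c : R} (P : Matrix (Fin n) (Fin n) R) {M : Matrix (Fin n) (Fin n) R}
    (h : ∀ e f : Fin k → Fin n, c ∣ (M.submatrix e f).det) (e f : Fin k → Fin n) :
    c ∣ ((P * M).submatrix e f).det := by
  have h1 : ((P * M).submatrix e f) =
      fun i => ∑ l, P (e i) l • (fun j => M l (f j)) := by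
    ext i j
    simp [Matrix.mul_apply, Finset.sum_apply]
  have h2 := (Matrix.detRowAlternating (n := Fin k) (R := R)).toMultilinearMap.map_sum
    (fun i l => P (e i) l • (fun j => M l (f j)))
  have h3 : ((P * M).submatrix e f).det = ∑ r : Fin k → Fin n,
      Matrix.detRowAlternating (fun i => P (e i) (r i) • (fun j => M (r i) (f j))) := by
    rw [h1]
    exact h2
  rw [h3]
  refine Finset.dvd_sum fun r _ => ?_
  have h4 := (Matrix.detRowAlternating (n := Fin k) (R := R)).toMultilinearMap.map_smul_univ
    (fun i => P (e i) (r i)) (fun i => (fun j => M (r i) (f j)))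
  refine Dvd.dvd.trans ?_ (dvd_of_eq h4.symm)
  exact (h r f).mul_left _

theorem dvd_minors_mul_right {c : R} (T : Matrix (Fin n) (Fin n) R) {M : Matrix (Fin n) (Fin n) R}
    (h : ∀ e f : Fin k → Fin n, c ∣ (M.submatrix e f).det) (e f : Fin k → Fin n) :
    c ∣ ((M * T).submatrix e f).det := by
  have := dvd_minors_mul_left (M := M.transpose) (c := c) T.transpose (k := k) (fun e f => by
    rw [← Matrix.transpose_submatrix, Matrix.det_transpose]
    exact h f e) f e
  rwa [← Matrix.transpose_mul, ← Matrix.transpose_submatrix, Matrix.det_transpose] at this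

theorem strictMono_castLE_le {f : Fin k → Fin n} (hf : StrictMono f) (hk : k ≤ n) (i : Fin k) :
    Fin.castLE hk i ≤ f i := by
  rw [Fin.le_def, Fin.val_castLE]
  obtain ⟨i, hi⟩ := i
  induction i with
  | zero => exact Nat.zero_le _
  | succ i ih =>
    exact (ih (by omega)).trans_lt (hf (a := ⟨i, by omega⟩) (b := ⟨i + 1, hi⟩) (by simp))

theorem prod_castLE_dvd_prod {a : Fin n → R} (ha : ∀ i j, i ≤ j → a i ∣ a j) (hk : k ≤ n)
    {f : Fin k → Fin n} (hf : Function.Injective f) :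
    ∏ i, a (Fin.castLE hk i) ∣ ∏ i, a (f i) := by
  classical
  have hcard : (Finset.univ.image f).card = k := by
    rw [Finset.card_image_of_injective _ hf, Finset.card_univ, Fintype.card_fin]
  have h1 : ∏ i, a (f i) = ∏ i, a ((Finset.univ.image f).orderEmbOfFin hcard i) := by
    rw [← Finset.prod_image (s := Finset.univ) (g := f) (f := a) (fun x _ y _ h => hf h),
      ← Finset.prod_image (s := Finset.univ) (g := (Finset.univ.image f).orderEmbOfFin hcard)
        (f := a) (fun x _ y _ h => (RelEmbedding.injective _) h),
      Finset.image_orderEmbOfFin_univ]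
  rw [h1]
  exact Finset.prod_dvd_prod_of_dvd _ _ fun i _ =>
    ha _ _ (strictMono_castLE_le (OrderEmbedding.strictMono _) hk i)

theorem prod_castLE_dvd_minors_diagonal {a : Fin n → R} (ha : ∀ i j, i ≤ j → a i ∣ a j)
    (hk : k ≤ n) (e f : Fin k → Fin n) :
    ∏ i, a (Fin.castLE hk i) ∣ ((Matrix.diagonal a).submatrix e f).det := by
  by_cases hf : Function.Injective f
  · rw [Matrix.det_apply]
    refine Finset.dvd_sum fun σ _ => ?_
    refine Dvd.dvd.trans ?_ (dvd_of_eq (Units.smul_def _ _).symm)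
    rw [zsmul_eq_mul]
    refine Dvd.dvd.mul_left ?_ _
    by_cases h : ∀ i, e (σ i) = f i
    · have : ∏ i, (Matrix.diagonal a).submatrix e f (σ i) i = ∏ i, a (f i) :=
        Finset.prod_congr rfl fun i _ => by rw [Matrix.submatrix_apply, h i,
          Matrix.diagonal_apply_eq]
      rw [this]
      exact prod_castLE_dvd_prod ha hk hf
    · push Not at h
      obtain ⟨i, hi⟩ := h
      have : ∏ i, (Matrix.diagonal a).submatrix e f (σ i) i = 0 :=
        Finset.prod_eq_zero (Finset.mem_univ i)
          (by rw [Matrix.submatrix_apply, Matrix.diagonal_apply_ne _ hi])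
      rw [this]
      exact dvd_zero _
  · rw [Function.not_injective_iff] at hf
    obtain ⟨i, j, hij, hne⟩ := hf
    rw [Matrix.det_zero_of_column_eq hne (fun l => by simp [hij])]
    exact dvd_zero _

/-- If a diagonal matrix `diag a` along a divisor chain is transformed into `diag b`, then the
leading products of the `a i` divide those of the `b i`: these products are divisors of all minors
of the given size. -/
theorem prod_castLE_dvd_of_mul_diagonal_mul {a b : Fin n → R} (ha : ∀ i j, i ≤ j → a i ∣ a j)
    {P T : Matrix (Fin n) (Fin n) R} (h : P * Matrix.diagonal a * T = Matrix.diagonal b)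
    (hk : k ≤ n) :
    ∏ i, a (Fin.castLE hk i) ∣ ∏ i, b (Fin.castLE hk i) := by
  have h1 := dvd_minors_mul_right T (dvd_minors_mul_left P
    (prod_castLE_dvd_minors_diagonal ha hk)) (Fin.castLE hk) (Fin.castLE hk)
  rw [h, Matrix.submatrix_diagonal _ _ (Fin.castLE_injective hk), Matrix.det_diagonal] at h1
  exact h1

end minors

/-! ### Existence and uniqueness of the Smith normal form -/

/-- `Fin (n + 1)` split into its first element and the rest. -/
def headTailEquiv (n : ℕ) : Unit ⊕ Fin n ≃ Fin (n + 1) where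
  toFun := Sum.elim (fun _ => 0) Fin.succ
  invFun := Fin.cons (Sum.inl ()) Sum.inr
  left_inv := by rintro (_ | _) <;> simp
  right_inv i := by cases i using Fin.cases <;> simp

@[simp] theorem headTailEquiv_inl (n : ℕ) (x : Unit) : headTailEquiv n (Sum.inl x) = 0 := rfl

@[simp] theorem headTailEquiv_inr (n : ℕ) (i : Fin n) : headTailEquiv n (Sum.inr i) = i.succ := rfl

@[simp] theorem headTailEquiv_symm_zero (n : ℕ) : (headTailEquiv n).symm 0 = Sum.inl () := rfl

@[simp] theorem headTailEquiv_symm_succ (n : ℕ) (i : Fin n) :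
    (headTailEquiv n).symm i.succ = Sum.inr i := rfl

theorem diagonal_sumElim_submatrix_headTailEquiv {R : Type*} [Zero R] {n : ℕ} (c : R)
    (a : Fin n → R) :
    (Matrix.diagonal (Sum.elim (fun _ : Unit => c) a)).submatrix (headTailEquiv n).symm
      (headTailEquiv n).symm = Matrix.diagonal (Fin.cons c a : Fin (n + 1) → R) := by
  rw [Matrix.submatrix_diagonal_equiv]
  congr 1
  funext i
  cases i using Fin.cases <;> simp

/-- Two square matrices are equivalent if invertible matrices `P`, `T` with `P M T = N` exist. -/
def MatrixEquivalent {R ι : Type*} [CommRing R] [Fintype ι] [DecidableEq ι]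
    (M N : Matrix ι ι R) : Prop :=
  ∃ P T : Matrix ι ι R, IsUnit P ∧ IsUnit T ∧ P * M * T = N

namespace MatrixEquivalent
variable {R ι κ : Type*} [CommRing R] [Fintype ι] [DecidableEq ι] [Fintype κ] [DecidableEq κ]
  {M N L : Matrix ι ι R}

theorem refl (M : Matrix ι ι R) : MatrixEquivalent M M :=
  ⟨1, 1, isUnit_one, isUnit_one, by simp⟩

theorem trans (h : MatrixEquivalent M N) (h' : MatrixEquivalent N L) : MatrixEquivalent M L := by
  obtain ⟨P, T, hP, hT, rfl⟩ := h
  obtain ⟨P', T', hP', hT', rfl⟩ := h'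
  exact ⟨P' * P, T * T', hP'.mul hP, hT.mul hT', by simp only [Matrix.mul_assoc]⟩

theorem symm (h : MatrixEquivalent M N) : MatrixEquivalent N M := by
  obtain ⟨P, T, ⟨P, rfl⟩, ⟨T, rfl⟩, rfl⟩ := h
  refine ⟨↑P⁻¹, ↑T⁻¹, Units.isUnit _, Units.isUnit _, ?_⟩
  rw [Matrix.mul_assoc (P : Matrix ι ι R), Units.inv_mul_cancel_left, Units.mul_inv_cancel_right]

theorem transpose (h : MatrixEquivalent M N) : MatrixEquivalent M.transpose N.transpose := by
  obtain ⟨P, T, hP, hT, rfl⟩ := h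
  refine ⟨T.transpose, P.transpose, Matrix.isUnit_transpose _ |>.2 hT,
    Matrix.isUnit_transpose _ |>.2 hP, ?_⟩
  simp only [Matrix.transpose_mul, Matrix.mul_assoc]

theorem mul_left {P : Matrix ι ι R} (hP : IsUnit P) (M : Matrix ι ι R) :
    MatrixEquivalent M (P * M) :=
  ⟨P, 1, hP, isUnit_one, by simp⟩

theorem mul_right {T : Matrix ι ι R} (hT : IsUnit T) (M : Matrix ι ι R) :
    MatrixEquivalent M (M * T) :=
  ⟨1, T, isUnit_one, hT, by simp⟩

theorem submatrix (h : MatrixEquivalent M N) (e : κ ≃ ι) :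
    MatrixEquivalent (M.submatrix e e) (N.submatrix e e) := by
  obtain ⟨P, T, hP, hT, rfl⟩ := h
  refine ⟨P.submatrix e e, T.submatrix e e, (Matrix.isUnit_submatrix_equiv _ _).2 hP,
    (Matrix.isUnit_submatrix_equiv _ _).2 hT, ?_⟩
  simp only [Matrix.submatrix_mul_equiv]

theorem smul (h : MatrixEquivalent M N) (c : R) : MatrixEquivalent (c • M) (c • N) := by
  obtain ⟨P, T, hP, hT, rfl⟩ := h
  exact ⟨P, T, hP, hT, by simp⟩

theorem fromBlocks_zero (h : MatrixEquivalent M N) (A : Matrix κ κ R) :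
    MatrixEquivalent (Matrix.fromBlocks A 0 0 M) (Matrix.fromBlocks A 0 0 N) := by
  obtain ⟨P, T, hP, hT, rfl⟩ := h
  refine ⟨Matrix.fromBlocks 1 0 0 P, Matrix.fromBlocks 1 0 0 T, ?_, ?_, ?_⟩
  · rw [Matrix.isUnit_iff_isUnit_det, Matrix.det_fromBlocks_zero₂₁] at *
    simpa using hP
  · rw [Matrix.isUnit_iff_isUnit_det, Matrix.det_fromBlocks_zero₂₁] at *
    simpa using hT
  · simp [Matrix.fromBlocks_multiply]

/-- Gaussian elimination with an invertible pivot. -/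
theorem fromBlocks_one (B : Matrix κ ι R) (C : Matrix ι κ R) (D : Matrix ι ι R) :
    MatrixEquivalent (Matrix.fromBlocks 1 B C D) (Matrix.fromBlocks 1 0 0 (D - C * B)) := by
  refine ⟨Matrix.fromBlocks 1 0 (-C) 1, Matrix.fromBlocks 1 (-B) 0 1, ?_, ?_, ?_⟩
  · rw [Matrix.isUnit_iff_isUnit_det, Matrix.det_fromBlocks_zero₁₂]
    simp
  · rw [Matrix.isUnit_iff_isUnit_det, Matrix.det_fromBlocks_zero₂₁]
    simp
  · simp [Matrix.fromBlocks_multiply, sub_eq_neg_add]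

end MatrixEquivalent

theorem isUnit_transvection {R ι : Type*} [CommRing R] [Fintype ι] [DecidableEq ι] {i j : ι}
    (h : i ≠ j) (c : R) : IsUnit (Matrix.transvection i j c) := by
  rw [Matrix.isUnit_iff_isUnit_det, Matrix.det_transvection_of_ne _ _ h]
  exact isUnit_one

theorem matrixEquivalent_submatrix_perm {R ι : Type*} [CommRing R] [Fintype ι] [DecidableEq ι]
    (M : Matrix ι ι R) (σ τ : Equiv.Perm ι) : MatrixEquivalent M (M.submatrix σ τ) := by
  have h1 := MatrixEquivalent.mul_right (T := (1 : Matrix ι ι R).submatrix (Equiv.refl ι) τ)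
    ((Matrix.isUnit_submatrix_equiv _ _).2 isUnit_one) M
  rw [Matrix.mul_submatrix_one] at h1
  have h2 := MatrixEquivalent.mul_left (P := (1 : Matrix ι ι R).submatrix σ (Equiv.refl ι))
    ((Matrix.isUnit_submatrix_equiv _ _).2 isUnit_one) (M.submatrix id τ)
  rw [Matrix.one_submatrix_mul] at h2
  exact h1.trans h2

section smith
variable {K : Type*} [Field K] {n : ℕ}

/-- The pivot `N 0 0` is nonzero and of least degree among the nonzero corner entries of all
matrices equivalent to `N`. -/
def HasMinimalPivot (N : Matrix (Fin (n + 1)) (Fin (n + 1)) K[X]) : Prop :=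
  N 0 0 ≠ 0 ∧ ∀ L, MatrixEquivalent N L → L 0 0 ≠ 0 → (N 0 0).natDegree ≤ (L 0 0).natDegree

theorem HasMinimalPivot.transpose {N : Matrix (Fin (n + 1)) (Fin (n + 1)) K[X]}
    (h : HasMinimalPivot N) : HasMinimalPivot N.transpose :=
  ⟨h.1, fun L hL hL0 => h.2 L.transpose (by simpa using hL.transpose) hL0⟩

theorem HasMinimalPivot.dvd_row {N : Matrix (Fin (n + 1)) (Fin (n + 1)) K[X]}
    (h : HasMinimalPivot N) (j : Fin (n + 1)) : N 0 0 ∣ N 0 j := by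
  rcases eq_or_ne j 0 with rfl | hj
  · exact dvd_rfl
  -- a nonzero remainder of `N 0 j` could be moved into the corner
  rw [← EuclideanDomain.mod_eq_zero]
  by_contra hr
  have h1 := (MatrixEquivalent.mul_right (isUnit_transvection hj.symm (-(N 0 j / N 0 0))) N).trans
    (matrixEquivalent_submatrix_perm _ 1 (Equiv.swap 0 j))
  have h2 : ((N * Matrix.transvection 0 j (-(N 0 j / N 0 0))).submatrix
      (1 : Equiv.Perm (Fin (n + 1))) (Equiv.swap 0 j)) 0 0 = N 0 j % N 0 0 := by
    rw [Matrix.submatrix_apply, Equiv.swap_apply_left, Equiv.Perm.one_apply,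
      Matrix.mul_transvection_apply_same]
    linear_combination -EuclideanDomain.mod_add_div (N 0 j) (N 0 0)
  have h3 := h.2 _ h1 (by rwa [h2])
  rw [h2] at h3
  have h4 : (N 0 j % N 0 0).degree < (N 0 0).degree := EuclideanDomain.mod_lt _ h.1
  exact absurd (natDegree_lt_natDegree hr h4) (by omega)

theorem HasMinimalPivot.dvd {N : Matrix (Fin (n + 1)) (Fin (n + 1)) K[X]}
    (h : HasMinimalPivot N) (i j : Fin (n + 1)) : N 0 0 ∣ N i j := by
  rcases eq_or_ne i 0 with rfl | hi
  · exact h.dvd_row j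
  obtain ⟨x, hx⟩ := h.transpose.dvd_row i
  simp only [Matrix.transpose_apply] at hx
  -- clear `N i 0`, then add row `i` to the first row
  set U := Matrix.transvection 0 i (1 : K[X]) * Matrix.transvection i 0 (-x)
  have hU : MatrixEquivalent N (U * N) :=
    MatrixEquivalent.mul_left ((isUnit_transvection hi.symm _).mul (isUnit_transvection hi _)) N
  have hUe : ∀ l, (U * N) 0 l = N 0 l + (N i l - x * N 0 l) := by
    intro l
    rw [Matrix.mul_assoc, Matrix.transvection_mul_apply_same, Matrix.transvection_mul_apply_same,
      Matrix.transvection_mul_apply_of_ne _ _ _ _ hi.symm]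
    ring
  have h0 : (U * N) 0 0 = N 0 0 := by
    rw [hUe]
    linear_combination hx
  have h1 : HasMinimalPivot (U * N) :=
    ⟨by rw [h0]; exact h.1, fun L hL => by rw [h0]; exact h.2 L (hU.trans hL)⟩
  have h2 := h1.dvd_row j
  rw [h0, hUe] at h2
  have h3 : N i j = (N 0 j + (N i j - x * N 0 j)) - (1 - x) * N 0 j := by ring
  rw [h3]
  exact dvd_sub h2 ((h.dvd_row j).mul_left _)

theorem exists_hasMinimalPivot {M : Matrix (Fin (n + 1)) (Fin (n + 1)) K[X]} (hM : M ≠ 0) :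
    ∃ N, MatrixEquivalent M N ∧ HasMinimalPivot N := by
  classical
  have hex : ∃ d : ℕ, ∃ N, MatrixEquivalent M N ∧ N 0 0 ≠ 0 ∧ (N 0 0).natDegree = d := by
    obtain ⟨i, j, hij⟩ : ∃ i j, M i j ≠ 0 := by
      by_contra h
      push Not at h
      exact hM (Matrix.ext h)
    exact ⟨_, _, matrixEquivalent_submatrix_perm M (Equiv.swap 0 i) (Equiv.swap 0 j),
      by simpa using hij, rfl⟩
  obtain ⟨N, hN, hN0, hd⟩ := Nat.find_spec hex
  exact ⟨N, hN, hN0, fun L hL hL0 => by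
    rw [hd]
    exact Nat.find_min' hex ⟨L, hN.trans hL, hL0, rfl⟩⟩

theorem exists_smith_diagonal : ∀ {n : ℕ} (M : Matrix (Fin n) (Fin n) K[X]),
    ∃ a : Fin n → K[X], MatrixEquivalent M (Matrix.diagonal a) ∧
      (∀ i, a i = 0 ∨ (a i).Monic) ∧ ∀ i j, i ≤ j → a i ∣ a j := by
  intro n
  induction n with
  | zero => exact fun M => ⟨fun _ => 0, by rw [Subsingleton.elim M]; exact .refl _,
      fun i => i.elim0, fun i => i.elim0⟩
  | succ n ih =>
    intro M
    by_cases hM : M = 0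
    · exact ⟨fun _ => 0, by rw [hM, Matrix.diagonal_zero]; exact .refl _,
        fun _ => .inl rfl, fun _ _ _ => dvd_rfl⟩
    obtain ⟨N, hMN, hN⟩ := exists_hasMinimalPivot hM
    set l := (N 0 0).leadingCoeff with hl
    have hl0 : l ≠ 0 := leadingCoeff_ne_zero.2 hN.1
    set c := N 0 0 * C l⁻¹ with hcdef
    have hc : c.Monic := monic_mul_leadingCoeff_inv hN.1
    choose L hL using fun i j => hN.dvd i j
    have hL00 : L 0 0 = 1 := mul_left_cancel₀ hN.1 (by rw [← hL, mul_one])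
    -- `C l⁻¹ • N = c • L`
    have hNL : MatrixEquivalent N (c • (Matrix.of L)) := by
      refine ⟨C l⁻¹ • 1, 1, ?_, isUnit_one, ?_⟩
      · rw [Matrix.isUnit_iff_isUnit_det, Matrix.det_smul, Matrix.det_one, mul_one]
        exact (isUnit_C.2 (inv_ne_zero hl0).isUnit).pow _
      · ext i j
        simp only [Matrix.mul_one, Matrix.smul_mul, Matrix.one_mul, Matrix.smul_apply, smul_eq_mul,
          Matrix.of_apply]
        rw [hL i j, hcdef]
        ring_nf
    set e := headTailEquiv n
    set L' := (Matrix.of L).submatrix e e with hL'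
    have h11 : L'.toBlocks₁₁ = 1 := by
      ext i j
      simp [Matrix.toBlocks₁₁, hL', e, hL00]
    have hLe : MatrixEquivalent L'
        (Matrix.fromBlocks 1 0 0 (L'.toBlocks₂₂ - L'.toBlocks₂₁ * L'.toBlocks₁₂)) := by
      conv_lhs => rw [← Matrix.fromBlocks_toBlocks L', h11]
      exact .fromBlocks_one _ _ _
    obtain ⟨a, ha, hmon, hchain⟩ := ih (L'.toBlocks₂₂ - L'.toBlocks₂₁ * L'.toBlocks₁₂)
    have h2 := ((hLe.trans (ha.fromBlocks_zero (1 : Matrix Unit Unit K[X]))).submatrix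
      e.symm).smul c
    refine ⟨Fin.cons c fun i => c * a i, ?_, ?_, ?_⟩
    · refine (hMN.trans hNL).trans ?_
      convert h2 using 1
      · ext i j
        simp [hL']
      · rw [← Matrix.diagonal_one, Matrix.fromBlocks_diagonal,
          diagonal_sumElim_submatrix_headTailEquiv, ← Matrix.diagonal_smul]
        congr 1
        funext i
        cases i using Fin.cases <;> simp
    · intro i
      cases i using Fin.cases with
      | zero => exact .inr hc
      | succ i => exact (hmon i).imp (fun h => by simp [h]) fun h => by simpa using hc.mul h
    · intro i j hij
      cases i using Fin.cases with
      | zero => cases j using Fin.cases <;> simp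
      | succ i =>
        cases j using Fin.cases with
        | zero => exact absurd hij (by simp)
        | succ j => simpa using mul_dvd_mul_left c (hchain i j (by simpa using hij))

theorem rank_diagonal_of_ne_zero_iff {R : Type*} [CommRing R] [IsDomain R] {a : Fin n → R} {r : ℕ}
    (hr : r ≤ n) (ha : ∀ i : Fin n, a i ≠ 0 ↔ (i : ℕ) < r) : (Matrix.diagonal a).rank = r := by
  classical
  apply le_antisymm
  · refine (Matrix.rank_le_card_of_support_subset _ (Finset.univ.image (Fin.castLE hr)) ?_).trans
      (Finset.card_image_le.trans (by simp))
    intro i hi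
    have : a i ≠ 0 := by
      rintro h
      refine hi (funext fun j => ?_)
      simp [Matrix.row, Matrix.diagonal_apply, h]
    simp only [Finset.coe_image, Finset.coe_univ, Set.image_univ, Set.mem_range]
    exact ⟨⟨i, (ha i).1 this⟩, rfl⟩
  · refine le_trans (le_of_eq ?_) (Matrix.rank_submatrix_le _ (Fin.castLE hr) (Fin.castLE hr))
    rw [Matrix.submatrix_diagonal _ _ (Fin.castLE_injective hr), Matrix.rank_of_det_ne_zero,
      Fintype.card_fin]
    rw [Matrix.det_diagonal]
    exact Finset.prod_ne_zero_iff.2 fun i _ => (ha _).2 i.2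

theorem MatrixEquivalent.rank_eq {R ι : Type*} [CommRing R] [Fintype ι] [DecidableEq ι]
    {M N : Matrix ι ι R} (h : MatrixEquivalent M N) : M.rank = N.rank := by
  obtain ⟨P, T, hP, hT, rfl⟩ := h
  rw [Matrix.rank_mul_eq_left_of_isUnit_det _ _ ((Matrix.isUnit_iff_isUnit_det _).1 hT),
    Matrix.rank_mul_eq_right_of_isUnit_det _ _ ((Matrix.isUnit_iff_isUnit_det _).1 hP)]

theorem exists_isMonicSmithNormalForm (M : Matrix (Fin n) (Fin n) K[X]) :
    ∃ D, IsMonicSmithNormalForm M D := by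
  classical
  obtain ⟨a, ha, hmon, hchain⟩ := exists_smith_diagonal M
  obtain ⟨r, hr, hra⟩ : ∃ r ≤ n, ∀ i : Fin n, a i ≠ 0 ↔ (i : ℕ) < r := by
    have hex : ∃ r, ∀ i : Fin n, r ≤ (i : ℕ) → a i = 0 :=
      ⟨n, fun i hi => absurd i.2 (not_lt.2 hi)⟩
    refine ⟨Nat.find hex, Nat.find_min' hex fun i hi => absurd i.2 (not_lt.2 hi), fun i => ?_⟩
    refine ⟨fun h => not_le.1 fun h' => h (Nat.find_spec hex i h'), fun h h0 => ?_⟩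
    exact Nat.find_min hex h fun j hij => zero_dvd_iff.1 (h0 ▸ hchain i j hij)
  have hrank : M.rank = r := ha.rank_eq.trans (rank_diagonal_of_ne_zero_iff hr hra)
  obtain ⟨P, T, hP, hT, h⟩ := ha
  refine ⟨_, a, rfl, fun i hi => ?_, fun i hi => ?_, hchain, P, T, hP, hT, h⟩
  · exact (hmon i).resolve_left ((hra i).2 (hrank ▸ hi))
  · by_contra h0
    exact absurd ((hra i).1 h0) (not_lt.2 (hrank ▸ hi))

theorem isMonicSmithNormalForm_unique {M D D' : Matrix (Fin n) (Fin n) K[X]}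
    (h : IsMonicSmithNormalForm M D) (h' : IsMonicSmithNormalForm M D') : D = D' := by
  obtain ⟨a, rfl, ha1, ha0, ha, P, T, hP, hT, hD⟩ := h
  obtain ⟨b, rfl, hb1, hb0, hb, P', T', hP', hT', hD'⟩ := h'
  have hab : MatrixEquivalent (Matrix.diagonal a) (Matrix.diagonal b) :=
    MatrixEquivalent.trans (.symm ⟨P, T, hP, hT, hD⟩) ⟨P', T', hP', hT', hD'⟩
  have hrn : M.rank ≤ n := M.rank_le_width
  have hprod : ∀ k (hk : k ≤ M.rank), ∏ i, a (Fin.castLE (hk.trans hrn) i) =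
      ∏ i, b (Fin.castLE (hk.trans hrn) i) := by
    intro k hk
    refine eq_of_monic_of_associated
      (monic_prod_of_monic _ _ fun i _ => ha1 _ (i.2.trans_le hk))
      (monic_prod_of_monic _ _ fun i _ => hb1 _ (i.2.trans_le hk)) (associated_of_dvd_dvd ?_ ?_)
    · obtain ⟨_, _, _, _, h⟩ := hab
      exact prod_castLE_dvd_of_mul_diagonal_mul ha h _
    · obtain ⟨_, _, _, _, h⟩ := hab.symm
      exact prod_castLE_dvd_of_mul_diagonal_mul hb h _
  congr 1
  funext i
  rcases lt_or_ge (i : ℕ) M.rank with hi | hi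
  · have h1 := hprod (i + 1) hi
    rw [Fin.prod_univ_castSucc, Fin.prod_univ_castSucc] at h1
    have h2 := hprod i hi.le
    have h3 : ∏ l : Fin i, a (Fin.castLE (hi.le.trans hrn) l) ≠ 0 :=
      (monic_prod_of_monic _ _ fun l _ => ha1 _ (l.2.trans hi)).ne_zero
    refine mul_left_cancel₀ h3 ?_
    calc _ = _ := h1
      _ = _ := by rw [h2]; rfl
  · rw [ha0 i hi, hb0 i hi]

theorem reducedDet_ne_zero (M : Matrix (Fin n) (Fin n) K[X]) : reducedDet M ≠ 0 := by
  obtain ⟨D, a, rfl, ha1, ha0, ha, P, T, hP, hT, hD⟩ := exists_isMonicSmithNormalForm M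
  unfold reducedDet
  split_ifs with h
  · exact h
  · intro h0
    rw [← Submodule.IsPrincipal.eq_bot_iff_generator_eq_zero, Ideal.span_eq_bot] at h0
    -- all minors of size `rank M` would vanish, hence also those of the normal form
    have h1 := dvd_minors_mul_right T (dvd_minors_mul_left (c := 0) P (k := M.rank)
      (M := M) fun e f => zero_dvd_iff.2 (h0 _ ⟨(e, f), rfl⟩))
    have hrn : M.rank ≤ n := M.rank_le_width
    have h2 := h1 (Fin.castLE hrn) (Fin.castLE hrn)
    rw [hD, zero_dvd_iff, Matrix.submatrix_diagonal _ _ (Fin.castLE_injective hrn),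
      Matrix.det_diagonal] at h2
    exact (monic_prod_of_monic _ _ fun i _ => ha1 _ i.2).ne_zero h2

end smith

/-! ### Congruence up to factors coprime to `d` -/

/-- `M` and `N` are congruent up to factors coprime to `d`: `S* M S = c c* N` where `det S` and `c`
are coprime to `d`. For polynomial matrices this is congruence over the ring of fractions whose
denominators are coprime to `d`, with denominators cleared. -/
def CongruentAwayFrom {R ι : Type*} [CommRing R] [StarRing R] [Fintype ι] [DecidableEq ι] (d : R)
    (M N : Matrix ι ι R) : Prop :=
  ∃ (S : Matrix ι ι R) (c : R), IsCoprime S.det d ∧ IsCoprime c d ∧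
    S.conjTranspose * M * S = (c * star c) • N

namespace CongruentAwayFrom
variable {R ι κ : Type*} [CommRing R] [StarRing R] [Fintype ι] [DecidableEq ι] [Fintype κ]
  [DecidableEq κ] {d : R} {M N L : Matrix ι ι R}

theorem of_conjTranspose_mul_mul {S : Matrix ι ι R} (hS : IsCoprime S.det d)
    (h : S.conjTranspose * M * S = N) : CongruentAwayFrom d M N :=
  ⟨S, 1, hS, isCoprime_one_left, by simp [h]⟩

theorem refl (d : R) (M : Matrix ι ι R) : CongruentAwayFrom d M M :=
  of_conjTranspose_mul_mul (S := 1) (by simpa using isCoprime_one_left) (by simp)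

theorem trans (h : CongruentAwayFrom d M N) (h' : CongruentAwayFrom d N L) :
    CongruentAwayFrom d M L := by
  obtain ⟨S, c, hS, hc, h⟩ := h
  obtain ⟨S', c', hS', hc', h'⟩ := h'
  refine ⟨S * S', c * c', by rw [Matrix.det_mul]; exact hS.mul_left hS', hc.mul_left hc', ?_⟩
  calc (S * S').conjTranspose * M * (S * S')
      = S'.conjTranspose * (S.conjTranspose * M * S) * S' := by
        simp only [Matrix.conjTranspose_mul, Matrix.mul_assoc]
    _ = (c * star c) • (S'.conjTranspose * N * S') := by
        rw [h, Matrix.mul_smul, Matrix.smul_mul]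
    _ = _ := by
        rw [h', smul_smul, star_mul]
        congr 1
        ring

/-- The inverse congruence is given by the adjugate matrix. -/
theorem symm (h : CongruentAwayFrom d M N) : CongruentAwayFrom d N M := by
  obtain ⟨S, c, hS, hc, h⟩ := h
  refine ⟨c • S.adjugate, S.det, ?_, hS, ?_⟩
  · rw [Matrix.det_smul, Matrix.det_adjugate]
    exact hc.pow_left.mul_left hS.pow_left
  · have h1 : S.adjugate.conjTranspose * S.conjTranspose = star S.det • 1 := by
      rw [← Matrix.conjTranspose_mul, Matrix.mul_adjugate, Matrix.conjTranspose_smul,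
        Matrix.conjTranspose_one]
    calc (c • S.adjugate).conjTranspose * N * (c • S.adjugate)
        = S.adjugate.conjTranspose * ((c * star c) • N) * S.adjugate := by
          simp only [Matrix.conjTranspose_smul, Matrix.smul_mul, Matrix.mul_smul, smul_smul]
      _ = (S.adjugate.conjTranspose * S.conjTranspose) * M * (S * S.adjugate) := by
          rw [← h]
          simp only [Matrix.mul_assoc]
      _ = _ := by
          rw [h1, Matrix.mul_adjugate]
          simp only [Matrix.smul_mul, Matrix.mul_smul, smul_smul, Matrix.one_mul, Matrix.mul_one]

theorem submatrix (h : CongruentAwayFrom d M N) (e : κ ≃ ι) :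
    CongruentAwayFrom d (M.submatrix e e) (N.submatrix e e) := by
  obtain ⟨S, c, hS, hc, h⟩ := h
  refine ⟨S.submatrix e e, c, by rwa [Matrix.det_submatrix_equiv_self], hc, ?_⟩
  rw [Matrix.conjTranspose_submatrix, Matrix.submatrix_mul_equiv, Matrix.submatrix_mul_equiv, h]
  rfl

theorem fromBlocks_right (h : CongruentAwayFrom d M N) (A : Matrix κ κ R) :
    CongruentAwayFrom d (Matrix.fromBlocks M 0 0 A) (Matrix.fromBlocks N 0 0 A) := by
  obtain ⟨S, c, hS, hc, h⟩ := h
  refine ⟨Matrix.fromBlocks S 0 0 (c • 1), c, ?_, hc, ?_⟩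
  · rw [Matrix.det_fromBlocks_zero₂₁, Matrix.det_smul, Matrix.det_one, mul_one]
    exact hS.mul_left hc.pow_left
  · simp [Matrix.fromBlocks_conjTranspose, Matrix.fromBlocks_multiply, h, Matrix.fromBlocks_smul,
      smul_smul]

theorem fromBlocks_left (h : CongruentAwayFrom d M N) (A : Matrix κ κ R) :
    CongruentAwayFrom d (Matrix.fromBlocks A 0 0 M) (Matrix.fromBlocks A 0 0 N) := by
  have := (h.fromBlocks_right A).submatrix (Equiv.sumComm κ ι)
  simpa using this

theorem diagonal {a b e : ι → R} (he : ∀ i, IsCoprime (e i) d)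
    (h : ∀ i, e i * star (e i) * a i = b i) :
    CongruentAwayFrom d (Matrix.diagonal a) (Matrix.diagonal b) := by
  refine of_conjTranspose_mul_mul (S := Matrix.diagonal e) ?_ ?_
  · rw [Matrix.det_diagonal]
    exact IsCoprime.prod_left fun i _ => he i
  · rw [Matrix.diagonal_conjTranspose, Matrix.diagonal_mul_diagonal, Matrix.diagonal_mul_diagonal]
    congr 1
    funext i
    rw [← h i]
    simp only [Pi.star_apply]
    ring

end CongruentAwayFrom

theorem star_algebraMap_ratFunc {K : Type*} [Field K] [StarRing K] (p : K[X]) :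
    star (algebraMap K[X] (RatFunc K) p) = algebraMap K[X] (RatFunc K) (star p) := by
  have := ratFuncConj_div p 1
  simp only [star_one, map_one, div_one] at this
  exact this

/-- Dividing `S` by `c` turns a congruence away from `d` into a congruence over a ring of fractions
in which `det S` and `c` are invertible. -/
theorem CongruentAwayFrom.congruentOver {K : Type*} [Field K] [StarRing K] {n : ℕ} {d e : K[X]}
    {M N : Matrix (Fin n) (Fin n) K[X]} (h : CongruentAwayFrom d N M)
    (hde : ∀ b, IsCoprime b d → b ≠ 0 ∧ IsCoprime b e) :
    CongruentOver (fractionsCoprimeTo e) M N := by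
  obtain ⟨S, c, hS, hc, h⟩ := h
  set A := algebraMap K[X] (RatFunc K)
  have hpoly : ∀ p, A p ∈ fractionsCoprimeTo e := fun p =>
    ⟨p, 1, one_ne_zero, isCoprime_one_left, by simp [A]⟩
  let s : K[X] →+* fractionsCoprimeTo e := A.codRestrict _ hpoly
  have hunit : ∀ b, IsCoprime b d → ∃ v : fractionsCoprimeTo e, s b * v = 1 ∧
      (v : RatFunc K) = (A b)⁻¹ := by
    intro b hb
    obtain ⟨hb0, hbe⟩ := hde b hb
    refine ⟨⟨(A b)⁻¹, 1, b, hb0, hbe, by simp [A]⟩, Subtype.ext ?_, rfl⟩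
    exact mul_inv_cancel₀ (RatFunc.algebraMap_ne_zero hb0)
  obtain ⟨v, hv, hvc⟩ := hunit c hc
  obtain ⟨w, hw, -⟩ := hunit S.det hS
  have hSmap : (v • S.map s).map (fractionsCoprimeTo e).subtype = (A c)⁻¹ • S.map A := by
    ext i j
    simp [hvc, s]
  refine ⟨v • S.map s, ?_, ?_⟩
  · rw [Matrix.isUnit_iff_isUnit_det, Matrix.det_smul]
    have h1 : (S.map s).det = s S.det := (RingHom.map_det s S).symm
    rw [h1]
    exact ((IsUnit.of_mul_eq_one (s c) (by rw [mul_comm]; exact hv)).pow _).mul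
      (IsUnit.of_mul_eq_one w hw)
  · have h1 : (S.map A).conjTranspose = S.conjTranspose.map A := by
      ext i j
      simp only [Matrix.conjTranspose_apply, Matrix.map_apply]
      exact star_algebraMap_ratFunc _
    have hc0 : A c ≠ 0 := RatFunc.algebraMap_ne_zero (hde c hc).1
    have hc0' : star (A c) ≠ 0 := star_ne_zero.2 hc0
    have h2 : (S.map A).conjTranspose * N.map A * S.map A = (A c * star (A c)) • M.map A := by
      rw [h1, ← Matrix.map_mul, ← Matrix.map_mul, h, star_algebraMap_ratFunc, ← map_mul]
      ext i j
      simp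
    rw [hSmap, Matrix.conjTranspose_smul, Matrix.smul_mul, Matrix.smul_mul, Matrix.mul_smul, h2,
      smul_smul, smul_smul, star_inv₀]
    rw [show (star (A c))⁻¹ * (A c)⁻¹ * (A c * star (A c)) = 1 by field_simp, one_smul]

/-! ### Real polynomials inside `𝕜[t]` -/

section real
variable {𝕜 : Type*} [RCLike 𝕜]

/-- The inclusion of `ℝ[t]` into `𝕜[t]`. -/
noncomputable def realPoly (𝕜 : Type*) [RCLike 𝕜] : ℝ[X] →+* 𝕜[X] :=
  Polynomial.mapRingHom (algebraMap ℝ 𝕜)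

theorem star_poly_coeff (f : 𝕜[X]) (n : ℕ) : (star f).coeff n = star (f.coeff n) :=
  coeff_map _ _

theorem realPoly_coeff (f : ℝ[X]) (n : ℕ) : (realPoly 𝕜 f).coeff n = (f.coeff n : 𝕜) :=
  coeff_map _ _

@[simp] theorem star_realPoly (f : ℝ[X]) : star (realPoly 𝕜 f) = realPoly 𝕜 f := by
  ext n
  rw [star_poly_coeff, realPoly_coeff]
  exact RCLike.conj_ofReal _

theorem realPoly_injective : Function.Injective (realPoly 𝕜) :=
  Polynomial.map_injective _ (algebraMap ℝ 𝕜).injective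

@[simp] theorem realPoly_eq_zero {f : ℝ[X]} : realPoly 𝕜 f = 0 ↔ f = 0 :=
  map_eq_zero_iff _ realPoly_injective

theorem exists_realPoly_eq {f : 𝕜[X]} (hf : star f = f) : ∃ g : ℝ[X], realPoly 𝕜 g = f := by
  have : f ∈ Polynomial.lifts (algebraMap ℝ 𝕜) := by
    rw [Polynomial.lifts_iff_coeff_lifts]
    intro n
    have h1 := star_poly_coeff f n
    rw [hf] at h1
    obtain ⟨r, hr⟩ := RCLike.conj_eq_iff_real.1 h1.symm
    exact ⟨r, hr.symm⟩
  exact (Polynomial.mem_lifts _).1 this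

theorem eval_realPoly (f : ℝ[X]) (x : ℝ) :
    (realPoly 𝕜 f).eval ((x : ℝ) : 𝕜) = ((f.eval x : ℝ) : 𝕜) :=
  (Polynomial.eval_map _ _).trans (Polynomial.eval₂_at_apply (algebraMap ℝ 𝕜) x)

theorem eval_star (f : 𝕜[X]) (x : ℝ) : (star f).eval (x : 𝕜) = star (f.eval (x : 𝕜)) := by
  have h := Polynomial.hom_eval₂ f (RingHom.id 𝕜) (starRingEnd 𝕜) (x : 𝕜)
  have h1 : (star f).eval (x : 𝕜) = f.eval₂ (starRingEnd 𝕜) (x : 𝕜) := Polynomial.eval_map _ _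
  rw [h1]
  rw [RCLike.conj_ofReal] at h
  exact h.symm

theorem isCoprime_realPoly_iff {f g : ℝ[X]} :
    IsCoprime (realPoly 𝕜 f) (realPoly 𝕜 g) ↔ IsCoprime f g :=
  Polynomial.isCoprime_map _

theorem dvd_realPoly_iff {f g : ℝ[X]} : realPoly 𝕜 f ∣ realPoly 𝕜 g ↔ f ∣ g :=
  Polynomial.map_dvd_map' _

theorem IsCoprime.star_realPoly {f : 𝕜[X]} {g : ℝ[X]} (h : IsCoprime f (realPoly 𝕜 g)) :
    IsCoprime (star f) (realPoly 𝕜 g) := by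
  have := h.map (starRingEnd 𝕜[X])
  rwa [starRingEnd_apply, starRingEnd_apply, _root_.star_realPoly] at this

/-- A monic real polynomial `a` and a cofactor `g` coprime to it are both nonnegative on the real
line if `a g` is: the closed sets where both are `≥ 0` and where both are `≤ 0` cover the line and
are disjoint. -/
theorem eval_nonneg_of_isCoprime_of_mul_nonneg {a g : ℝ[X]} (ha : a.Monic) (hag : IsCoprime a g)
    (h : ∀ x, 0 ≤ (a * g).eval x) : (∀ x, 0 ≤ a.eval x) ∧ ∀ x, 0 ≤ g.eval x := by
  have hcl : ∀ f : ℝ[X], IsClosed {x | 0 ≤ f.eval x} := fun f =>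
    isClosed_le continuous_const f.continuous
  have hcl' : ∀ f : ℝ[X], IsClosed {x | f.eval x ≤ 0} := fun f =>
    isClosed_le f.continuous continuous_const
  have hcover : (Set.univ : Set ℝ) ⊆ ({x | 0 ≤ a.eval x} ∩ {x | 0 ≤ g.eval x}) ∪
      ({x | a.eval x ≤ 0} ∩ {x | g.eval x ≤ 0}) := by
    intro x _
    have := h x
    rw [eval_mul] at this
    rcases mul_nonneg_iff.1 this with h1 | h1
    · exact .inl h1
    · exact .inr h1
  have hpre := isPreconnected_closed_iff.1 (isPreconnected_univ (α := ℝ)) _ _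
    ((hcl a).inter (hcl g)) ((hcl' a).inter (hcl' g)) hcover
  have hdisj : ∀ x, ¬(a.eval x = 0 ∧ g.eval x = 0) := by
    rintro x ⟨h1, h2⟩
    obtain ⟨u, v, huv⟩ := hag
    have := congrArg (eval x) huv
    simp [h1, h2] at this
  by_cases hneg : ∃ x, a.eval x < 0 ∨ g.eval x < 0
  · exfalso
    obtain ⟨x, hx⟩ := hneg
    have hall : ∀ y, a.eval y ≤ 0 := by
      intro y
      by_contra hy
      have hx' : x ∈ {x | a.eval x ≤ 0} ∩ {x | g.eval x ≤ 0} :=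
        (hcover (Set.mem_univ x)).resolve_left fun h1 =>
          hx.elim (not_lt.2 h1.1) (not_lt.2 h1.2)
      have hy' := (hcover (Set.mem_univ y)).resolve_right fun h1 => hy h1.1
      obtain ⟨z, -, hz⟩ := hpre ⟨y, Set.mem_univ y, hy'⟩ ⟨x, Set.mem_univ x, hx'⟩
      exact hdisj z ⟨le_antisymm hz.2.1 hz.1.1, le_antisymm hz.2.2 hz.1.2⟩
    -- a monic polynomial takes positive values
    rcases eq_or_ne a 1 with rfl | h1
    · have := hall 0
      norm_num at this
    · have hdeg : 0 < a.degree := by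
        rw [ha.degree_pos]
        exact h1
      have := a.tendsto_atTop_of_leadingCoeff_nonneg hdeg (by rw [ha.leadingCoeff]; norm_num)
      obtain ⟨y, hy⟩ := (this.eventually (Filter.eventually_gt_atTop 0)).exists
      exact absurd (hall y) (not_le.2 hy)
  · push Not at hneg
    exact ⟨fun x => (hneg x).1, fun x => (hneg x).2⟩

end real

/-! ### Diagonalization of hermitian polynomial matrices -/

section hermitian
variable {𝕜 : Type*} [RCLike 𝕜]

/-- The sesquilinear form `v* N w` with Gram matrix `N`. -/
def sesqForm {R ι : Type*} [CommRing R] [StarRing R] [Fintype ι] (N : Matrix ι ι R)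
    (v w : ι → R) : R :=
  dotProduct (star v) (N.mulVec w)

section sesqForm
variable {R ι : Type*} [CommRing R] [StarRing R] [Fintype ι] (N : Matrix ι ι R)

theorem sesqForm_add_left (u v w : ι → R) :
    sesqForm N (u + v) w = sesqForm N u w + sesqForm N v w := by
  simp [sesqForm, add_dotProduct]

theorem sesqForm_add_right (u v w : ι → R) :
    sesqForm N u (v + w) = sesqForm N u v + sesqForm N u w := by
  simp [sesqForm, Matrix.mulVec_add, dotProduct_add]

theorem sesqForm_smul_left (c : R) (v w : ι → R) :
    sesqForm N (c • v) w = star c * sesqForm N v w := by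
  simp [sesqForm, star_smul, smul_dotProduct]

theorem sesqForm_smul_right (c : R) (v w : ι → R) :
    sesqForm N v (c • w) = c * sesqForm N v w := by
  simp [sesqForm, Matrix.mulVec_smul, dotProduct_smul]

theorem sesqForm_single [DecidableEq ι] (i j : ι) :
    sesqForm N (Pi.single i 1) (Pi.single j 1) = N i j := by
  simp [sesqForm]

variable {N} in
theorem star_sesqForm (hN : N.IsHermitian) (v w : ι → R) :
    star (sesqForm N v w) = sesqForm N w v := by
  rw [sesqForm, Matrix.star_dotProduct, star_star, Matrix.star_mulVec, hN.eq, sesqForm,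
    Matrix.dotProduct_mulVec, dotProduct_comm, dotProduct_comm]

theorem conjTranspose_mul_mul_apply (S : Matrix ι ι R) (i j : ι) :
    (S.conjTranspose * N * S) i j = sesqForm N (fun k => S k i) (fun k => S k j) := by
  rw [Matrix.mul_assoc, Matrix.mul_apply]
  rfl

end sesqForm

theorem dvd_of_dvd_two_mul {p f : 𝕜[X]} (h : p ∣ 2 * f) : p ∣ f := by
  have h2 : C (1 / 2 : 𝕜) * 2 = 1 := by
    rw [show (2 : 𝕜[X]) = C 2 from rfl, ← C_mul]
    norm_num
  have h3 : f = C (1 / 2 : 𝕜) * (2 * f) := by rw [← mul_assoc, h2, one_mul]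
  rw [h3]
  exact h.mul_left _

theorem star_C (z : 𝕜) : star (C z : 𝕜[X]) = C (star z) :=
  Polynomial.map_C _

/-- If all the values `v* N v` at vectors with `i₀`-th coordinate `1` are divisible by `p`, then so
are the entries of `N`, by polarization. -/
theorem dvd_apply_of_dvd_sesqForm {ι : Type*} [Fintype ι] [DecidableEq ι] {N : Matrix ι ι 𝕜[X]}
    (hN : N.IsHermitian) {p : 𝕜[X]} (i₀ : ι)
    (h : ∀ v, v i₀ = 1 → p ∣ sesqForm N v v) (i j : ι) : p ∣ N i j := by
  set x : ι → 𝕜[X] := Pi.single i₀ 1 with hx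
  have hxx : p ∣ sesqForm N x x := h x (by simp [hx])
  have hplus : ∀ w : ι → 𝕜[X], w i₀ = 0 → p ∣ sesqForm N (x + w) (x + w) :=
    fun w hw => h _ (by simp [hx, hw])
  have hdiag : ∀ w : ι → 𝕜[X], w i₀ = 0 → p ∣ sesqForm N w w := by
    intro w hw
    have h1 := dvd_sub (dvd_add (hplus w hw) (hplus ((-1 : 𝕜[X]) • w) (by simp [hw])))
      (hxx.mul_left 2)
    refine dvd_of_dvd_two_mul (h1.trans (dvd_of_eq ?_))
    simp only [sesqForm_add_left, sesqForm_add_right, sesqForm_smul_left, sesqForm_smul_right,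
      star_neg, star_one]
    ring
  have hsymm : ∀ u w : ι → 𝕜[X], (u = x ∨ u i₀ = 0) → w i₀ = 0 →
      p ∣ sesqForm N u w + sesqForm N w u := by
    intro u w hu hw
    have h1 : p ∣ sesqForm N (u + w) (u + w) - sesqForm N u u - sesqForm N w w := by
      refine dvd_sub (dvd_sub ?_ ?_) (hdiag w hw)
      · rcases hu with rfl | hu
        · exact hplus w hw
        · exact hdiag _ (by simp [hu, hw])
      · rcases hu with rfl | hu
        · exact hxx
        · exact hdiag _ hu
    refine h1.trans (dvd_of_eq ?_)
    simp only [sesqForm_add_left, sesqForm_add_right]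
    ring
  have hboth : ∀ u w : ι → 𝕜[X], (u = x ∨ u i₀ = 0) → w i₀ = 0 →
      p ∣ sesqForm N u w ∧ p ∣ sesqForm N w u := by
    intro u w hu hw
    have h1 := hsymm u w hu hw
    have h2 : p ∣ sesqForm N u w - sesqForm N w u := by
      rcases RCLike.I_mul_I (K := 𝕜) with hI | hI
      · -- here `𝕜 = ℝ` and the form is symmetric
        have htriv : ∀ f : 𝕜[X], star f = f := by
          intro f
          ext n
          rw [star_poly_coeff]
          exact RCLike.conj_eq_iff_im.2 (RCLike.im_eq_zero hI _)
        rw [← star_sesqForm hN u w, htriv, sub_self]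
        exact dvd_zero _
      · have h3 := hsymm u ((C (RCLike.I : 𝕜)) • w) hu (by simp [hw])
        rw [sesqForm_smul_left, sesqForm_smul_right, star_C] at h3
        have h4 : (C (star (RCLike.I : 𝕜)) : 𝕜[X]) = -C RCLike.I := by
          rw [← C_neg]
          exact congrArg C RCLike.conj_I
        have h5 : (C (RCLike.I : 𝕜) : 𝕜[X]) * C RCLike.I = -1 := by
          rw [← C_mul, hI, C_neg, C_1]
        rw [h4] at h3
        refine (h3.mul_left (-C RCLike.I)).trans (dvd_of_eq ?_)
        linear_combination -(sesqForm N u w - sesqForm N w u) * h5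
    constructor
    · refine dvd_of_dvd_two_mul ((dvd_add h1 h2).trans (dvd_of_eq ?_))
      ring
    · refine dvd_of_dvd_two_mul ((dvd_sub h1 h2).trans (dvd_of_eq ?_))
      ring
  have hsingle : ∀ i, i ≠ i₀ → (Pi.single i 1 : ι → 𝕜[X]) i₀ = 0 := fun i hi => by
    rw [Pi.single_eq_of_ne hi.symm]
  have hcase : ∀ i, (Pi.single i 1 : ι → 𝕜[X]) = x ∨ (Pi.single i 1 : ι → 𝕜[X]) i₀ = 0 := by
    intro i
    rcases eq_or_ne i i₀ with rfl | hi
    · exact .inl rfl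
    · exact .inr (hsingle i hi)
  rw [← sesqForm_single N i j]
  by_cases hj : j = i₀
  · by_cases hi : i = i₀
    · rw [hi, hj]
      exact hxx
    · exact (hboth _ _ (hcase j) (hsingle i hi)).2
  · exact (hboth _ _ (hcase i) (hsingle j hj)).1

theorem exists_realPoly_eq_sesqForm {ι : Type*} [Fintype ι] {N : Matrix ι ι 𝕜[X]}
    (hN : N.IsHermitian) (v : ι → 𝕜[X]) : ∃ g, realPoly 𝕜 g = sesqForm N v v :=
  exists_realPoly_eq (star_sesqForm hN v v)

/-- If no irreducible real polynomial divides all entries of `N`, the form `v* N v` takes a value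
coprime to a given `d ≠ 0`, at a vector with a coordinate equal to `1`: such vectors exist modulo
each prime, and are combined by the Chinese remainder theorem. -/
theorem exists_sesqForm_isCoprime {ι : Type*} [Fintype ι] [DecidableEq ι] {N : Matrix ι ι 𝕜[X]}
    (hN : N.IsHermitian) (i₀ : ι)
    (h : ∀ p : ℝ[X], Irreducible p → ∃ i j, ¬realPoly 𝕜 p ∣ N i j) {d : ℝ[X]} (hd : d ≠ 0) :
    ∃ v, v i₀ = 1 ∧ IsCoprime (sesqForm N v v) (realPoly 𝕜 d) := by
  induction d using UniqueFactorizationMonoid.induction_on_coprime with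
  | h0 => exact absurd rfl hd
  | h1 hu =>
    refine ⟨Pi.single i₀ 1, by simp, ?_⟩
    obtain ⟨u, hu⟩ := (hu.map (realPoly 𝕜)).exists_left_inv
    exact ⟨0, u, by rw [hu]; ring⟩
  | @hpr π k hπ =>
    obtain ⟨i, j, hij⟩ := h π hπ.irreducible
    obtain ⟨v, hv, hvπ⟩ : ∃ v : ι → 𝕜[X], v i₀ = 1 ∧ ¬realPoly 𝕜 π ∣ sesqForm N v v := by
      by_contra hcon
      push Not at hcon
      exact hij (dvd_apply_of_dvd_sesqForm hN i₀ hcon i j)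
    refine ⟨v, hv, ?_⟩
    obtain ⟨g, hg⟩ := exists_realPoly_eq_sesqForm hN v
    rw [← hg, dvd_realPoly_iff] at hvπ
    rw [← hg, isCoprime_realPoly_iff]
    exact ((hπ.irreducible.coprime_iff_not_dvd.2 hvπ).symm).pow_right
  | @hcp x y hxy hx hy =>
    obtain ⟨hx0, hy0⟩ := mul_ne_zero_iff.1 hd
    obtain ⟨v, hv, hvx⟩ := hx hx0
    obtain ⟨w, hw, hwy⟩ := hy hy0
    obtain ⟨a, b, hab⟩ := hxy.isCoprime
    have hab' : realPoly 𝕜 (a * x) + realPoly 𝕜 (b * y) = 1 := by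
      rw [← map_add, hab, map_one]
    have key : ∀ (u z : ι → 𝕜[X]) (s t : ℝ[X]), IsCoprime (sesqForm N u u) (realPoly 𝕜 t) →
        IsCoprime (sesqForm N (u + (realPoly 𝕜 (s * t)) • z) (u + (realPoly 𝕜 (s * t)) • z))
          (realPoly 𝕜 t) := by
      intro u z s t hu
      have : sesqForm N (u + (realPoly 𝕜 (s * t)) • z) (u + (realPoly 𝕜 (s * t)) • z) =
          sesqForm N u u + realPoly 𝕜 t * (realPoly 𝕜 s * (sesqForm N u z + sesqForm N z u +
            realPoly 𝕜 (s * t) * sesqForm N z z)) := by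
        simp only [sesqForm_add_left, sesqForm_add_right, sesqForm_smul_left, sesqForm_smul_right,
          star_realPoly]
        simp only [map_mul]
        ring
      rw [this]
      exact hu.add_mul_left_left _
    have heq : v + realPoly 𝕜 (a * x) • (w - v) = w + realPoly 𝕜 (b * y) • (v - w) := by
      ext1 i
      simp only [Pi.add_apply, Pi.smul_apply, Pi.sub_apply, smul_eq_mul]
      linear_combination (w i - v i) * hab'
    refine ⟨v + realPoly 𝕜 (a * x) • (w - v), by simp [hv, hw], ?_⟩
    rw [map_mul _ x y]
    refine IsCoprime.mul_right (key v (w - v) a x hvx) ?_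
    rw [heq]
    exact key w (v - w) b y hwy

/-- A nonzero matrix is a real polynomial times a matrix whose entries have no common real
factor. -/
theorem exists_realPoly_smul_eq {ι : Type*} {M : Matrix ι ι 𝕜[X]} (hM : M ≠ 0) :
    ∃ (a : ℝ[X]) (N : Matrix ι ι 𝕜[X]), a ≠ 0 ∧ M = realPoly 𝕜 a • N ∧
      ∀ p : ℝ[X], Irreducible p → ∃ i j, ¬realPoly 𝕜 p ∣ N i j := by
  classical
  obtain ⟨i₀, j₀, hij⟩ : ∃ i j, M i j ≠ 0 := by
    by_contra h
    push Not at h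
    exact hM (Matrix.ext h)
  let P : ℕ → Prop := fun k => ∃ a : ℝ[X], a.natDegree = k ∧ a ≠ 0 ∧ ∀ i j, realPoly 𝕜 a ∣ M i j
  have hbound : ∀ k, P k → k ≤ (M i₀ j₀).natDegree := by
    rintro k ⟨a, rfl, ha, h⟩
    have := natDegree_le_of_dvd (h i₀ j₀) hij
    rwa [show (realPoly 𝕜 a).natDegree = a.natDegree from
      natDegree_map_eq_of_injective (algebraMap ℝ 𝕜).injective a] at this
  obtain ⟨a, hak, ha0, ha⟩ : P (Nat.findGreatest P (M i₀ j₀).natDegree) :=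
    Nat.findGreatest_spec (m := 0) (Nat.zero_le _) ⟨1, by simp, one_ne_zero, by simp⟩
  choose N hN using ha
  refine ⟨a, Matrix.of N, ha0, ?_, ?_⟩
  · ext1 i j
    simpa using hN i j
  · intro p hp
    by_contra hcon
    push Not at hcon
    have h1 : P (a * p).natDegree := ⟨_, rfl, mul_ne_zero ha0 hp.ne_zero, fun i j => by
      rw [hN, map_mul]
      exact mul_dvd_mul_left _ (hcon i j)⟩
    have h2 := Nat.le_findGreatest (hbound _ h1) h1
    rw [← hak, natDegree_mul ha0 hp.ne_zero] at h2
    have := hp.natDegree_pos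
    omega

/-- Away from a given `d ≠ 0`, a hermitian polynomial matrix can be diagonalized along a divisor
chain of real polynomials. A vector on which the form takes a value dividing all entries, up to a
factor coprime to `d`, splits off as an orthogonal summand. -/
theorem exists_conjTranspose_mul_mul_eq_diagonal {d : ℝ[X]} (hd : d ≠ 0) : ∀ {n : ℕ}
    {M : Matrix (Fin n) (Fin n) 𝕜[X]}, M.IsHermitian →
    ∃ (S : Matrix (Fin n) (Fin n) 𝕜[X]) (b : Fin n → ℝ[X]), IsCoprime S.det (realPoly 𝕜 d) ∧
      S.conjTranspose * M * S = Matrix.diagonal (fun i => realPoly 𝕜 (b i)) ∧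
      ∀ i j, i ≤ j → b i ∣ b j := by
  intro n
  induction n with
  | zero => exact fun _ => ⟨1, fun _ => 0, by simpa using isCoprime_one_left,
      Subsingleton.elim _ _, fun i => i.elim0⟩
  | succ n ih =>
    intro M hM
    by_cases hM0 : M = 0
    · exact ⟨1, fun _ => 0, by simpa using isCoprime_one_left, by simp [hM0], fun _ _ _ => dvd_rfl⟩
    obtain ⟨a, N, ha, rfl, hNp⟩ := exists_realPoly_smul_eq hM0
    set e := headTailEquiv n
    have hN : N.IsHermitian := by
      have h1 := hM.eq
      rw [Matrix.conjTranspose_smul, star_realPoly] at h1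
      exact smul_right_injective _ (by simpa using ha) h1
    have hN' : (N.submatrix e e).IsHermitian := hN.submatrix e
    obtain ⟨v, hv, hvd⟩ := exists_sesqForm_isCoprime hN' (Sum.inl ())
      (fun p hp => by
        obtain ⟨i, j, hij⟩ := hNp p hp
        exact ⟨e.symm i, e.symm j, by simpa using hij⟩) hd
    obtain ⟨g, hg⟩ := exists_realPoly_eq_sesqForm hN' v
    rw [← hg] at hvd
    -- make `v` the first basis vector
    set P : Matrix (Unit ⊕ Fin n) (Unit ⊕ Fin n) 𝕜[X] :=
      Matrix.fromBlocks 1 0 (Matrix.of fun i _ => v (Sum.inr i)) 1 with hP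
    have hPdet : P.det = 1 := by
      rw [hP, Matrix.det_fromBlocks_zero₁₂]
      simp
    set Q := P.conjTranspose * N.submatrix e e * P with hQ
    have hQherm : Q.IsHermitian := Matrix.isHermitian_conjTranspose_mul_mul P hN'
    have hPcol : (fun k => P k (Sum.inl ())) = v := by
      funext k
      rcases k with k | k
      · simp [hP, hv]
      · simp [hP]
    have hQ11 : Q.toBlocks₁₁ = realPoly 𝕜 g • 1 := by
      ext1 i j
      change Q (Sum.inl ()) (Sum.inl ()) = _
      rw [hQ, conjTranspose_mul_mul_apply, hPcol, hg]
      simp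
    set R := Q.toBlocks₂₁ with hR
    set B := Q.toBlocks₂₂ with hB
    have hQ12 : Q.toBlocks₁₂ = R.conjTranspose := by
      ext1 i j
      exact (hQherm.apply _ _).symm
    have hQb : Q = Matrix.fromBlocks (realPoly 𝕜 g • 1) R.conjTranspose R B := by
      rw [← hQ11, ← hQ12, hR, hB, Matrix.fromBlocks_toBlocks]
    have hBh : B.IsHermitian := by
      ext1 i j
      exact hQherm.apply _ _
    -- clear the first row and column
    set W : Matrix (Unit ⊕ Fin n) (Unit ⊕ Fin n) 𝕜[X] :=
      Matrix.fromBlocks 1 (-R.conjTranspose) 0 (realPoly 𝕜 g • 1) with hW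
    have hWQ : W.conjTranspose * Q * W = Matrix.fromBlocks (realPoly 𝕜 g • 1) 0 0
        (realPoly 𝕜 g • (realPoly 𝕜 g • B - R * R.conjTranspose)) := by
      rw [hQb, hW]
      simp only [Matrix.fromBlocks_conjTranspose, Matrix.fromBlocks_multiply,
        Matrix.conjTranspose_one, Matrix.conjTranspose_zero, Matrix.conjTranspose_neg,
        Matrix.conjTranspose_smul, Matrix.conjTranspose_conjTranspose, star_realPoly]
      congr 1
      · simp
      · simp
      · simp
      · simp [sub_eq_neg_add]
    obtain ⟨S', b, hS', hSb, hchain⟩ := ih (M := realPoly 𝕜 g • B - R * R.conjTranspose) (by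
      have h1 : (realPoly 𝕜 g • B).IsHermitian := by
        rw [Matrix.IsHermitian, Matrix.conjTranspose_smul, star_realPoly, hBh.eq]
      exact h1.sub (Matrix.isHermitian_mul_conjTranspose_self R))
    set V : Matrix (Unit ⊕ Fin n) (Unit ⊕ Fin n) 𝕜[X] := Matrix.fromBlocks 1 0 0 S' with hV
    have hfinal : (P * W * V).conjTranspose * N.submatrix e e * (P * W * V) =
        Matrix.diagonal (Sum.elim (fun _ => realPoly 𝕜 g)
          fun i => realPoly 𝕜 g * realPoly 𝕜 (b i)) := by
      have h1 : (P * W * V).conjTranspose * N.submatrix e e * (P * W * V) =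
          V.conjTranspose * (W.conjTranspose * Q * W) * V := by
        simp only [hQ, Matrix.conjTranspose_mul, Matrix.mul_assoc]
      rw [h1, hWQ, hV, Matrix.fromBlocks_conjTranspose, Matrix.fromBlocks_multiply,
        Matrix.fromBlocks_multiply, ← Matrix.fromBlocks_diagonal]
      congr 1
      · simp [Matrix.smul_one_eq_diagonal]
      · simp
      · simp
      · simp only [Matrix.conjTranspose_zero, Matrix.zero_mul, Matrix.mul_zero, zero_add,
          Matrix.mul_smul, Matrix.smul_mul, hSb, ← Matrix.diagonal_smul, add_zero]
        rfl
    refine ⟨(P * W * V).submatrix e.symm e.symm, Fin.cons (a * g) fun i => a * g * b i, ?_, ?_, ?_⟩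
    · rw [Matrix.det_submatrix_equiv_self, Matrix.det_mul, Matrix.det_mul, hPdet, one_mul, hW, hV,
        Matrix.det_fromBlocks_zero₂₁, Matrix.det_fromBlocks_zero₂₁, Matrix.det_one, one_mul,
        one_mul, Matrix.det_smul, Matrix.det_one, mul_one]
      exact hvd.pow_left.mul_left hS'
    · have h1 := congrArg (fun L => realPoly 𝕜 a • L.submatrix e.symm e.symm) hfinal
      simp only [diagonal_sumElim_submatrix_headTailEquiv, e] at h1
      rw [← Matrix.submatrix_mul_equiv _ _ _ e.symm, ← Matrix.submatrix_mul_equiv _ _ _ e.symm,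
        ← Matrix.conjTranspose_submatrix, Matrix.submatrix_submatrix] at h1
      rw [Matrix.mul_smul, Matrix.smul_mul]
      refine Eq.trans ?_ (h1.trans ?_)
      · simp [e]
      · rw [← Matrix.diagonal_smul]
        congr 1
        funext i
        cases i using Fin.cases <;> simp [mul_assoc]
    · intro i j hij
      cases i using Fin.cases with
      | zero => cases j using Fin.cases <;> simp
      | succ i =>
        cases j using Fin.cases with
        | zero => exact absurd hij (by simp)
        | succ j => simpa using mul_dvd_mul_left (a * g) (hchain i j (by simpa using hij))

end hermitian

/-! ### Congruence of diagonal forms -/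

section diagonalForms
variable {𝕜 : Type*} [RCLike 𝕜]

theorem CongruentAwayFrom.diagonal_of_pair {R : Type*} [CommRing R] [StarRing R] {d : R} {n : ℕ}
    {f g : Fin (n + 2) → R} (hfg : ∀ i : Fin n, f i.succ.succ = g i.succ.succ)
    (h : CongruentAwayFrom d (Matrix.diagonal ![f 0, f 1]) (Matrix.diagonal ![g 0, g 1])) :
    CongruentAwayFrom d (Matrix.diagonal f) (Matrix.diagonal g) := by
  let e : Fin 2 ⊕ Fin n ≃ Fin (n + 2) := finSumFinEquiv.trans (finCongr (add_comm 2 n))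
  have hr : ∀ i : Fin n, e (Sum.inr i) = i.succ.succ := by
    intro i
    ext
    simp [e]
  have hl : ∀ f : Fin (n + 2) → R, f ∘ e = Sum.elim ![f 0, f 1] fun i => f i.succ.succ := by
    intro f
    funext i
    rcases i with i | i
    · fin_cases i
      · exact congrArg f (by ext; simp [e])
      · exact congrArg f (by ext; simp [e])
    · exact congrArg f (hr i)
  have h1 := (h.fromBlocks_right (Matrix.diagonal fun i : Fin n => f i.succ.succ)).submatrix e.symm
  rw [Matrix.fromBlocks_diagonal, Matrix.fromBlocks_diagonal, ← hl, funext hfg, ← hl,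
    ← Matrix.submatrix_diagonal_equiv, ← Matrix.submatrix_diagonal_equiv,
    Matrix.submatrix_submatrix, Matrix.submatrix_submatrix] at h1
  simpa using h1

theorem CongruentAwayFrom.diagonal_cons {R : Type*} [CommRing R] [StarRing R] {d : R} {n : ℕ}
    (c : R) {f g : Fin n → R}
    (h : CongruentAwayFrom d (Matrix.diagonal f) (Matrix.diagonal g)) :
    CongruentAwayFrom d (Matrix.diagonal (Fin.cons c f : Fin (n + 1) → R))
      (Matrix.diagonal (Fin.cons c g : Fin (n + 1) → R)) := by
  have h1 := (h.fromBlocks_left (Matrix.diagonal fun _ : Unit => c)).submatrix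
    (headTailEquiv n).symm
  rwa [Matrix.fromBlocks_diagonal, Matrix.fromBlocks_diagonal,
    diagonal_sumElim_submatrix_headTailEquiv, diagonal_sumElim_submatrix_headTailEquiv] at h1

/-- Positive factors coprime to `d` can be moved from one diagonal entry to another:
`⟨u a, v b⟩` is congruent to `⟨a, u v b⟩`, because `u X² + v a b Y² = Z²` has a solution with `Z`
coprime to `d`. -/
theorem congruentAwayFrom_diagonal_pair {d u v a b : ℝ[X]} (hd : d ≠ 0) (hu : u ≠ 0) (hv : v ≠ 0)
    (ha : a ≠ 0) (hb : b ≠ 0) (hud : IsCoprime u d) (hu0 : ∀ x, 0 ≤ u.eval x)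
    (hv0 : ∀ x, 0 ≤ v.eval x) (ha0 : ∀ x, 0 ≤ a.eval x) (hb0 : ∀ x, 0 ≤ b.eval x) :
    CongruentAwayFrom (realPoly 𝕜 d)
      (Matrix.diagonal ![realPoly 𝕜 (u * a), realPoly 𝕜 (v * b)])
      (Matrix.diagonal ![realPoly 𝕜 a, realPoly 𝕜 (u * v * b)]) := by
  obtain ⟨x, y, z, hz, h⟩ := exists_conic_solution_isCoprime (p := u) (q := v * (a * b)) hu
    (mul_ne_zero hv (mul_ne_zero ha hb)) hd hud hu0 (fun x => by
      simp only [eval_mul]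
      exact mul_nonneg (hv0 x) (mul_nonneg (ha0 x) (hb0 x)))
  have h' := congrArg (realPoly 𝕜) h
  simp only [map_add, map_mul, map_pow] at h'
  have hz' := isCoprime_realPoly_iff (𝕜 := 𝕜) |>.2 hz
  refine ⟨!![realPoly 𝕜 x, -realPoly 𝕜 (v * b * y); realPoly 𝕜 (a * y), realPoly 𝕜 (u * x)],
    realPoly 𝕜 z, ?_, hz', ?_⟩
  · rw [Matrix.det_fin_two_of]
    refine IsCoprime.of_isCoprime_of_dvd_left (hz'.pow_left (m := 2)) (dvd_of_eq ?_)
    simp only [map_mul]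
    linear_combination h'
  · ext1 i j
    fin_cases i <;> fin_cases j <;>
      simp [Matrix.mul_apply, Fin.sum_univ_two]
    · linear_combination realPoly 𝕜 a * h'
    · ring
    · ring
    · linear_combination realPoly 𝕜 u * realPoly 𝕜 v * realPoly 𝕜 b * h'

/-- Positive factors `u i` coprime to `d` can be removed from a positive diagonal form if their
product is a hermitian norm up to factors coprime to `d`. -/
theorem congruentAwayFrom_diagonal_of_prod {d : ℝ[X]} (hd : d ≠ 0) {σ γ : 𝕜[X]}
    (hσ : IsCoprime σ (realPoly 𝕜 d)) (hγ : IsCoprime γ (realPoly 𝕜 d)) : ∀ {n : ℕ}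
    {u a : Fin (n + 1) → ℝ[X]}, (∀ i, u i ≠ 0) → (∀ i, a i ≠ 0) → (∀ i, IsCoprime (u i) d) →
    (∀ i x, 0 ≤ (u i).eval x) → (∀ i x, 0 ≤ (a i).eval x) →
    σ * star σ * realPoly 𝕜 (∏ i, u i) = γ * star γ →
    CongruentAwayFrom (realPoly 𝕜 d) (Matrix.diagonal fun i => realPoly 𝕜 (u i * a i))
      (Matrix.diagonal fun i => realPoly 𝕜 (a i)) := by
  intro n
  induction n with
  | zero =>
    intro u a _ _ _ _ _ h
    refine ⟨Matrix.diagonal fun _ => σ, γ, by simpa using hσ, hγ, ?_⟩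
    rw [Matrix.diagonal_conjTranspose, Matrix.diagonal_mul_diagonal, Matrix.diagonal_mul_diagonal,
      ← Matrix.diagonal_smul]
    congr 1
    funext i
    rw [Fin.fin_one_eq_zero i]
    rw [Fin.prod_univ_one] at h
    simp only [Pi.star_apply, Pi.smul_apply, smul_eq_mul, map_mul]
    linear_combination realPoly 𝕜 (a 0) * h
  | succ n ih =>
    intro u a hu ha hud hu0 ha0 h
    set w : Fin (n + 1) → ℝ[X] := Fin.cons (u 0 * u 1) fun i => u i.succ.succ with hw
    have h1 : CongruentAwayFrom (realPoly 𝕜 d) (Matrix.diagonal fun i => realPoly 𝕜 (u i * a i))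
        (Matrix.diagonal (Fin.cons (realPoly 𝕜 (a 0)) fun i => realPoly 𝕜 (w i * a i.succ) :
          Fin (n + 2) → 𝕜[X])) := by
      refine CongruentAwayFrom.diagonal_of_pair (fun i => by simp [hw]) ?_
      exact congruentAwayFrom_diagonal_pair hd (hu 0) (hu 1) (ha 0) (ha 1) (hud 0) (hu0 0) (hu0 1)
        (ha0 0) (ha0 1)
    have h2 := CongruentAwayFrom.diagonal_cons (realPoly 𝕜 (a 0)) (ih (u := w)
      (a := fun i => a i.succ)
      (Fin.cases (mul_ne_zero (hu 0) (hu 1)) fun i => by simpa [hw] using hu _)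
      (fun i => ha _)
      (Fin.cases ((hud 0).mul_left (hud 1)) fun i => by simpa [hw] using hud _)
      (Fin.cases (fun x => by simpa [hw] using mul_nonneg (hu0 0 x) (hu0 1 x))
        fun i x => by simpa [hw] using hu0 _ x)
      (fun i => ha0 _)
      (by
        rw [← h, Fin.prod_univ_succ, Fin.prod_univ_succ, Fin.prod_univ_succ]
        simp [hw, mul_assoc]))
    refine h1.trans (h2.trans ?_)
    rw [show (Fin.cons (realPoly 𝕜 (a 0)) fun i => realPoly 𝕜 (a i.succ) : Fin (n + 2) → 𝕜[X]) =
      fun i => realPoly 𝕜 (a i) from funext fun i => by cases i using Fin.cases <;> simp]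
    exact .refl _ _

/-! ### Positive semidefinite forms and their Smith normal form -/

theorem exists_eval_ofReal_ne_zero {f : 𝕜[X]} (hf : f ≠ 0) : ∃ x : ℝ, f.eval (x : 𝕜) ≠ 0 := by
  by_contra h
  push Not at h
  refine hf (Polynomial.eq_zero_of_infinite_isRoot f
    ((Set.infinite_range_of_injective (RCLike.ofReal_injective (K := 𝕜))).mono ?_))
  rintro _ ⟨x, rfl⟩
  exact h x

theorem eval_mul_star (f : 𝕜[X]) (x : ℝ) :
    (f * star f).eval (x : 𝕜) = ((RCLike.normSq (f.eval (x : 𝕜)) : ℝ) : 𝕜) := by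
  rw [eval_mul, eval_star]
  exact RCLike.mul_conj _ |>.trans (by rw [RCLike.normSq_eq_def']; norm_cast)

/-- A unit `q` of `𝕜[t]` with `δ δ* q = c c* u`, where `u ≥ 0` on the real line, is a positive
constant. -/
theorem exists_C_sq_eq_of_isUnit {δ c q : 𝕜[X]} {u : ℝ[X]} (hδ : δ ≠ 0) (hq : IsUnit q)
    (hu : ∀ x, 0 ≤ u.eval x) (h : δ * star δ * q = c * star c * realPoly 𝕜 u) :
    ∃ r : ℝ, r ≠ 0 ∧ q = realPoly 𝕜 (C r ^ 2) := by
  obtain ⟨κ, hκ, rfl⟩ := Polynomial.isUnit_iff.1 hq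
  obtain ⟨x, hx⟩ := exists_eval_ofReal_ne_zero hδ
  have h1 := congrArg (eval (x : 𝕜)) h
  rw [eval_mul (p := δ * star δ), eval_mul (p := c * star c), eval_mul_star, eval_mul_star, eval_C,
    eval_realPoly] at h1
  set s := RCLike.normSq (δ.eval (x : 𝕜))
  set t := RCLike.normSq (c.eval (x : 𝕜)) * u.eval x with ht
  have hs : 0 < s := lt_of_le_of_ne (RCLike.normSq_nonneg _)
    (Ne.symm (by simpa [s] using hx))
  have ht0 : 0 ≤ t / s := div_nonneg (mul_nonneg (RCLike.normSq_nonneg _) (hu x)) hs.le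
  have hκ' : κ = ((t / s : ℝ) : 𝕜) := by
    have hs' : ((s : ℝ) : 𝕜) ≠ 0 := by exact_mod_cast hs.ne'
    rw [RCLike.ofReal_div, eq_div_iff hs', mul_comm, h1, ht, RCLike.ofReal_mul]
  refine ⟨Real.sqrt (t / s), ?_, ?_⟩
  · intro h0
    have : t / s = 0 := (Real.sqrt_eq_zero ht0).1 h0
    rw [this] at hκ'
    exact hκ.ne_zero (by simpa using hκ')
  · rw [← C_pow, Real.sq_sqrt ht0, hκ']
    exact (Polynomial.map_C _).symm

/-- The nonsingular case: a positive semidefinite form is congruent to its monic Smith normal form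
away from any multiple `d` of the determinant. A diagonalization `⟨b₀, …⟩` of the form is compared
with `⟨a₀, …⟩` through the leading products of the invariant factors, so that `⟨b₀, …⟩` becomes
`⟨u₀ a₀, …⟩` with `u i` coprime to `d`; positivity makes the `u i` positive, and the determinant
makes their product a norm. -/
theorem congruentAwayFrom_of_posSemidef {k : ℕ} {M : Matrix (Fin k) (Fin k) 𝕜[X]}
    (hM : M.IsHermitian)
    (hpos : ∀ (v : Fin k → 𝕜[X]) (x : ℝ), 0 ≤ RCLike.re ((sesqForm M v v).eval (x : 𝕜)))
    {a : Fin k → ℝ[X]} (ha : ∀ i, (a i).Monic) (hchain : ∀ i j, i ≤ j → a i ∣ a j)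
    (hMa : MatrixEquivalent (Matrix.diagonal fun i => realPoly 𝕜 (a i)) M)
    {d : ℝ[X]} (hd : d ≠ 0) (hdu : ¬IsUnit d) (had : ∀ i, a i ∣ d) :
    CongruentAwayFrom (realPoly 𝕜 d) M (Matrix.diagonal fun i => realPoly 𝕜 (a i)) := by
  rcases k with _ | k
  · rw [Subsingleton.elim M (Matrix.diagonal fun i => realPoly 𝕜 (a i))]
    exact .refl _ _
  have hne : ∀ {f : 𝕜[X]}, IsCoprime f (realPoly 𝕜 d) → f ≠ 0 := by
    rintro f hf rfl
    have h0 : IsCoprime (0 : ℝ[X]) d := by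
      rw [← isCoprime_realPoly_iff (𝕜 := 𝕜), map_zero]
      exact hf
    exact hdu (isCoprime_zero_left.1 h0)
  obtain ⟨S, b, hS, hSb, hbchain⟩ := exists_conjTranspose_mul_mul_eq_diagonal (𝕜 := 𝕜) hd hM
  obtain ⟨P, T, hP, hT, rfl⟩ := hMa
  have hb0 : ∀ i x, 0 ≤ (b i).eval x := by
    intro i x
    have h1 := congrFun (congrFun hSb i) i
    rw [conjTranspose_mul_mul_apply, Matrix.diagonal_apply_eq] at h1
    have h2 := hpos (fun l => S l i) x
    rwa [h1, eval_realPoly, RCLike.ofReal_re] at h2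
  -- the leading products of `a` and `b` agree up to factors `f j` coprime to `d`
  have hab : ∀ j (hj : j ≤ k + 1), ∃ f : ℝ[X], IsCoprime f d ∧
      ∏ i, b (Fin.castLE hj i) = (∏ i, a (Fin.castLE hj i)) * f := by
    intro j hj
    have h1 : ∏ i, a (Fin.castLE hj i) ∣ ∏ i, b (Fin.castLE hj i) := by
      rw [← dvd_realPoly_iff (𝕜 := 𝕜), map_prod, map_prod]
      refine prod_castLE_dvd_of_mul_diagonal_mul (b := fun i => realPoly 𝕜 (b i))
        (P := S.conjTranspose * P) (T := T * S)
        (fun i j hij => dvd_realPoly_iff.2 (hchain i j hij)) ?_ hj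
      rw [← hSb]
      simp only [Matrix.mul_assoc]
    have h2 : ∏ i, realPoly 𝕜 (b (Fin.castLE hj i)) ∣
        ∏ i, (S.det * star S.det * realPoly 𝕜 (a (Fin.castLE hj i))) := by
      obtain ⟨P, rfl⟩ := hP
      obtain ⟨T, rfl⟩ := hT
      set A := Matrix.diagonal fun i => realPoly 𝕜 (a i)
      have h3 : S.adjugate.conjTranspose * S.conjTranspose = star S.det • 1 := by
        rw [← Matrix.conjTranspose_mul, Matrix.mul_adjugate, Matrix.conjTranspose_smul,
          Matrix.conjTranspose_one]
      refine prod_castLE_dvd_of_mul_diagonal_mul (a := fun i => realPoly 𝕜 (b i))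
        (b := fun i => S.det * star S.det * realPoly 𝕜 (a i))
        (P := (↑P⁻¹ : Matrix _ _ 𝕜[X]) * S.adjugate.conjTranspose)
        (T := S.adjugate * (↑T⁻¹ : Matrix _ _ 𝕜[X]))
        (fun i j hij => dvd_realPoly_iff.2 (hbchain i j hij)) ?_ hj
      calc _ = (↑P⁻¹ : Matrix _ _ 𝕜[X]) * (S.adjugate.conjTranspose * S.conjTranspose) *
              ((P : Matrix _ _ 𝕜[X]) * A * (T : Matrix _ _ 𝕜[X])) * (S * S.adjugate) *
              (↑T⁻¹ : Matrix _ _ 𝕜[X]) := by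
            rw [← hSb]
            simp only [Matrix.mul_assoc]
        _ = (S.det * star S.det) • ((↑P⁻¹ : Matrix _ _ 𝕜[X]) *
              ((P : Matrix _ _ 𝕜[X]) * (A * ((T : Matrix _ _ 𝕜[X]) *
              (↑T⁻¹ : Matrix _ _ 𝕜[X]))))) := by
            rw [h3, Matrix.mul_adjugate]
            simp only [Matrix.smul_mul, Matrix.mul_smul, smul_smul, Matrix.mul_one,
              Matrix.mul_assoc]
        _ = (S.det * star S.det) • A := by
            rw [Units.mul_inv, Matrix.mul_one, Units.inv_mul_cancel_left]
        _ = _ := by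
            rw [← Matrix.diagonal_smul]
            rfl
    obtain ⟨f, hf⟩ := h1
    refine ⟨f, ?_, hf⟩
    rw [Finset.prod_mul_distrib, ← map_prod, ← map_prod, hf, map_mul, mul_comm] at h2
    have h3 : realPoly 𝕜 (∏ i, a (Fin.castLE hj i)) ≠ 0 := by
      rw [Ne, realPoly_eq_zero]
      exact (monic_prod_of_monic _ _ fun i _ => ha _).ne_zero
    have h4 := (mul_dvd_mul_iff_right h3).1 h2
    rw [← isCoprime_realPoly_iff (𝕜 := 𝕜)]
    refine IsCoprime.of_isCoprime_of_dvd_left ?_ h4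
    exact IsCoprime.prod_left fun _ _ => hS.mul_left hS.star_realPoly
  choose! f hfd hf using hab
  have hrel : ∀ i : Fin (k + 1), a i * f (i + 1) = f i * b i := by
    intro i
    have h1 := hf (i + 1) i.2
    rw [Fin.prod_univ_castSucc, Fin.prod_univ_castSucc] at h1
    have h2 := hf i i.2.le
    have h3 : ∏ l : Fin i, a (Fin.castLE i.2.le l) ≠ 0 :=
      (monic_prod_of_monic _ _ fun l _ => ha _).ne_zero
    refine mul_left_cancel₀ h3 ?_
    have h4 : (∏ l : Fin i, b (Fin.castLE i.2.le l)) * b i =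
      (∏ l : Fin i, a (Fin.castLE i.2.le l)) * a i * f (i + 1) := h1
    rw [h2] at h4
    linear_combination -h4
  set u : Fin (k + 1) → ℝ[X] := fun i => f i * f (i + 1) with hu
  have hud : ∀ i, IsCoprime (u i) d := fun i => (hfd i i.2.le).mul_left (hfd (i + 1) i.2)
  have hua : ∀ i, u i * a i = f i * f i * b i := by
    intro i
    simp only [hu]
    linear_combination f i * hrel i
  have hsign : ∀ i, (∀ x, 0 ≤ (a i).eval x) ∧ ∀ x, 0 ≤ (u i).eval x := by
    intro i
    refine eval_nonneg_of_isCoprime_of_mul_nonneg (ha i)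
      ((hud i).of_isCoprime_of_dvd_right (had i)).symm fun x => ?_
    rw [mul_comm, hua, eval_mul, eval_mul]
    exact mul_nonneg (mul_self_nonneg _) (hb0 i x)
  have hu0 : ∀ i, u i ≠ 0 := fun i h0 =>
    hne (isCoprime_realPoly_iff.2 (hud i)) (by rw [h0, map_zero])
  have hcong : CongruentAwayFrom (realPoly 𝕜 d)
      (P * (Matrix.diagonal fun i => realPoly 𝕜 (a i)) * T)
      (Matrix.diagonal fun i => realPoly 𝕜 (u i * a i)) := by
    refine (CongruentAwayFrom.of_conjTranspose_mul_mul hS hSb).trans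
      (CongruentAwayFrom.diagonal (e := fun i => realPoly 𝕜 (f i))
        (fun i => isCoprime_realPoly_iff.2 (hfd i i.2.le)) fun i => ?_)
    rw [hua, star_realPoly, map_mul, map_mul]
  refine hcong.trans ?_
  -- compare determinants
  obtain ⟨V, c, hV, hc, h⟩ := hcong
  have hdet := congrArg Matrix.det h
  rw [Matrix.det_mul, Matrix.det_mul, Matrix.det_mul, Matrix.det_mul, Matrix.det_conjTranspose,
    Matrix.det_smul, Matrix.det_diagonal, Matrix.det_diagonal, Fintype.card_fin, ← map_prod,
    ← map_prod, Finset.prod_mul_distrib, map_mul] at hdet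
  have ha0 : realPoly 𝕜 (∏ i, a i) ≠ 0 := by
    rw [Ne, realPoly_eq_zero]
    exact (monic_prod_of_monic _ _ fun i _ => ha _).ne_zero
  have hq : V.det * star V.det * (P.det * T.det) =
      c ^ (k + 1) * star (c ^ (k + 1)) * realPoly 𝕜 (∏ i, u i) := by
    refine mul_right_cancel₀ ha0 ?_
    rw [star_pow, ← mul_pow]
    linear_combination hdet
  obtain ⟨r, hr, hqr⟩ := exists_C_sq_eq_of_isUnit (hne hV)
    (((Matrix.isUnit_iff_isUnit_det _).1 hP).mul ((Matrix.isUnit_iff_isUnit_det _).1 hT))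
    (fun x => by
      rw [eval_prod]
      exact Finset.prod_nonneg fun i _ => (hsign i).2 x) hq
  refine congruentAwayFrom_diagonal_of_prod hd (σ := c ^ (k + 1)) (γ := realPoly 𝕜 (C r) * V.det)
    hc.pow_left ?_ hu0 (fun i => (ha i).ne_zero) hud (fun i => (hsign i).2)
    (fun i => (hsign i).1) ?_
  · refine IsCoprime.mul_left ?_ hV
    obtain ⟨w, hw⟩ := ((isUnit_C.2 hr.isUnit).map (realPoly 𝕜)).exists_left_inv
    exact ⟨w, 0, by rw [hw]; ring⟩
  · rw [← hq, hqr, star_mul, star_realPoly, map_pow]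
    ring

/-! ### Singular forms -/

theorem re_eval_sesqForm_nonneg {n : ℕ} {M : Matrix (Fin n) (Fin n) 𝕜[X]}
    (hM : IsPosSemidefPoly M) (v : Fin n → 𝕜[X]) (x : ℝ) :
    0 ≤ RCLike.re ((sesqForm M v v).eval (x : 𝕜)) := by
  have h := (hM.2 x).re_dotProduct_nonneg fun i => (v i).eval (x : 𝕜)
  refine h.trans_eq (congrArg RCLike.re ?_)
  simp only [sesqForm, dotProduct, Matrix.mulVec, eval_finsetSum, eval_mul, Pi.star_apply,
    eval_star, Matrix.map_apply]

theorem sesqForm_conjTranspose_mul_mul {R ι : Type*} [CommRing R] [StarRing R] [Fintype ι]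
    (N S : Matrix ι ι R) (v w : ι → R) :
    sesqForm (S.conjTranspose * N * S) v w = sesqForm N (S.mulVec v) (S.mulVec w) := by
  simp only [sesqForm, ← Matrix.mulVec_mulVec, Matrix.star_mulVec, ← Matrix.dotProduct_mulVec]

theorem sesqForm_submatrix {R ι κ : Type*} [CommRing R] [StarRing R] [Fintype ι] [Fintype κ]
    (N : Matrix ι ι R) (e : κ ≃ ι) (v w : κ → R) :
    sesqForm (N.submatrix e e) v w = sesqForm N (v ∘ e.symm) (w ∘ e.symm) := by
  rw [sesqForm, sesqForm, Matrix.submatrix_mulVec_equiv]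
  conv_rhs => rw [← comp_equiv_dotProduct_comp_equiv _ _ e]
  congr 1
  funext i
  simp

theorem sesqForm_fromBlocks_elim_zero {R ι κ : Type*} [CommRing R] [StarRing R] [Fintype ι]
    [Fintype κ] (N : Matrix ι ι R) (v w : ι → R) :
    sesqForm (Matrix.fromBlocks N 0 0 (0 : Matrix κ κ R)) (Sum.elim v 0) (Sum.elim w 0) =
      sesqForm N v w := by
  simp [sesqForm, Matrix.fromBlocks_mulVec, dotProduct]

/-- The monic Smith normal form of a hermitian matrix is real, as it coincides with its
conjugate. -/
theorem IsMonicSmithNormalForm.exists_realPoly {n : ℕ} {M D : Matrix (Fin n) (Fin n) 𝕜[X]}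
    (hM : M.IsHermitian) (h : IsMonicSmithNormalForm M D) :
    ∃ a : Fin n → ℝ[X], D = Matrix.diagonal (fun i => realPoly 𝕜 (a i)) ∧
      (∀ i : Fin n, (i : ℕ) < M.rank → (a i).Monic) ∧
      (∀ i : Fin n, M.rank ≤ (i : ℕ) → a i = 0) ∧ ∀ i j, i ≤ j → a i ∣ a j := by
  have h' := h
  obtain ⟨A, rfl, hA1, hA0, hA, P, T, hP, hT, hD⟩ := h
  have hstar : IsMonicSmithNormalForm M (Matrix.diagonal A).conjTranspose := by
    refine ⟨star A, Matrix.diagonal_conjTranspose _, fun i hi => (hA1 i hi).map _,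
      fun i hi => ?_, fun i j hij => ?_, T.conjTranspose, P.conjTranspose, ?_, ?_, ?_⟩
    · rw [Pi.star_apply, hA0 i hi, star_zero]
    · exact map_dvd (starRingEnd 𝕜[X]) (hA i j hij)
    · exact hT.star
    · exact hP.star
    · rw [← hD, Matrix.conjTranspose_mul, Matrix.conjTranspose_mul, hM.eq, Matrix.mul_assoc]
  have h1 := isMonicSmithNormalForm_unique hstar h'
  rw [Matrix.diagonal_conjTranspose, Matrix.diagonal_injective.eq_iff] at h1
  choose a ha using fun i => exists_realPoly_eq (congrFun h1 i)
  refine ⟨a, ?_, fun i hi => ?_, fun i hi => ?_, fun i j hij => ?_⟩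
  · congr 1
    funext i
    exact (ha i).symm
  · have := hA1 i hi
    rw [← ha] at this
    exact monic_of_injective (algebraMap ℝ 𝕜).injective this
  · rw [← realPoly_eq_zero (𝕜 := 𝕜), ha, hA0 i hi]
  · rw [← dvd_realPoly_iff (𝕜 := 𝕜), ha, ha]
    exact hA i j hij

/-- A positive semidefinite form is the orthogonal sum of a nonsingular form and a zero form: if
`P M T = D`, the matrix `T* M T` vanishes outside the upper left block of size `rank M`, and this
block has the Smith normal form given by the nonzero entries of `D`. -/
theorem IsMonicSmithNormalForm.congruentAwayFrom {n : ℕ} {M : Matrix (Fin n) (Fin n) 𝕜[X]}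
    (hM : IsPosSemidefPoly M) {a : Fin n → ℝ[X]}
    (h : IsMonicSmithNormalForm M (Matrix.diagonal fun i => realPoly 𝕜 (a i)))
    (ha1 : ∀ i : Fin n, (i : ℕ) < M.rank → (a i).Monic)
    (ha0 : ∀ i : Fin n, M.rank ≤ (i : ℕ) → a i = 0) (hchain : ∀ i j, i ≤ j → a i ∣ a j)
    {d : ℝ[X]} (hd : d ≠ 0) (hdu : ¬IsUnit d) (had : ∀ i : Fin n, (i : ℕ) < M.rank → a i ∣ d) :
    CongruentAwayFrom (realPoly 𝕜 d) M (Matrix.diagonal fun i => realPoly 𝕜 (a i)) := by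
  obtain ⟨-, -, -, -, -, P, T, hP, hT, hD⟩ := h
  set k := M.rank with hk
  have hkn : k ≤ n := M.rank_le_width
  let e : Fin k ⊕ Fin (n - k) ≃ Fin n :=
    finSumFinEquiv.trans (finCongr (by omega))
  have hel : ∀ i, e (Sum.inl i) = Fin.castLE hkn i := fun i => by ext; simp [e]
  have her : ∀ i, ((e (Sum.inr i) : Fin n) : ℕ) = k + i := fun i => by simp [e]
  set A : Fin k → ℝ[X] := fun i => a (Fin.castLE hkn i) with hA
  set D₀ : Matrix (Fin k) (Fin k) 𝕜[X] := Matrix.diagonal fun i => realPoly 𝕜 (A i) with hD₀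
  have hDe : (Matrix.diagonal fun i => realPoly 𝕜 (a i)).submatrix e e =
      Matrix.fromBlocks D₀ 0 0 0 := by
    rw [Matrix.submatrix_diagonal_equiv, ← Matrix.diagonal_zero, hD₀, Matrix.fromBlocks_diagonal]
    congr 1
    funext i
    rcases i with i | i
    · simp [hel, hA]
    · simp [ha0 (e (Sum.inr i)) (by rw [her]; omega)]
  set M' := M.submatrix e e
  set T' := T.submatrix e e with hT'
  have hT'u : IsUnit T' := (Matrix.isUnit_submatrix_equiv _ _).2 hT
  obtain ⟨P, rfl⟩ := hP
  set Q := T'.conjTranspose * (↑P⁻¹ : Matrix (Fin n) (Fin n) 𝕜[X]).submatrix e e with hQ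
  have hQu : IsUnit Q := (hT'u.star).mul ((Matrix.isUnit_submatrix_equiv _ _).2 (Units.isUnit _))
  have hTMT : T'.conjTranspose * M' * T' = Q * Matrix.fromBlocks D₀ 0 0 0 := by
    rw [hQ, ← hDe, ← hD, Matrix.mul_assoc, Matrix.mul_assoc, Matrix.submatrix_mul_equiv,
      Matrix.submatrix_mul_equiv, Matrix.mul_assoc (P : Matrix (Fin n) (Fin n) 𝕜[X]),
      Units.inv_mul_cancel_left]
  have hMh : M'.IsHermitian := hM.1.submatrix e
  have hherm : (T'.conjTranspose * M' * T').IsHermitian :=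
    Matrix.isHermitian_conjTranspose_mul_mul T' hMh
  have hblocks : Q * Matrix.fromBlocks D₀ 0 0 0 = Matrix.fromBlocks (Q.toBlocks₁₁ * D₀) 0
      (Q.toBlocks₂₁ * D₀) (0 : Matrix (Fin (n - k)) (Fin (n - k)) 𝕜[X]) := by
    conv_lhs => rw [← Matrix.fromBlocks_toBlocks Q]
    rw [Matrix.fromBlocks_multiply]
    simp
  have hA1 : ∀ i, (A i).Monic := fun i => ha1 _ i.2
  rw [hTMT, hblocks] at hherm
  have h21D : Q.toBlocks₂₁ * D₀ = 0 := by
    have := (Matrix.isHermitian_fromBlocks_iff.1 hherm).2.1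
    rw [← this, Matrix.conjTranspose_zero]
  have h21 : Q.toBlocks₂₁ = 0 := by
    ext1 i j
    have h1 := congrFun (congrFun h21D i) j
    rw [hD₀, Matrix.mul_diagonal] at h1
    exact (mul_eq_zero.1 h1).resolve_right (by simpa using (hA1 j).ne_zero)
  have hQ11 : IsUnit Q.toBlocks₁₁ := by
    have h1 := (Matrix.isUnit_iff_isUnit_det _).1 hQu
    rw [← Matrix.fromBlocks_toBlocks Q, h21, Matrix.det_fromBlocks_zero₂₁] at h1
    exact (Matrix.isUnit_iff_isUnit_det _).2 (isUnit_of_mul_isUnit_left h1)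
  rw [h21D] at hherm hblocks
  have hM₀ : CongruentAwayFrom (realPoly 𝕜 d) (Q.toBlocks₁₁ * D₀) D₀ := by
    refine congruentAwayFrom_of_posSemidef (Matrix.isHermitian_fromBlocks_iff.1 hherm).1 ?_ hA1
      (fun i j hij => hchain _ _ hij) (.mul_left hQ11 _) hd hdu (fun i => had _ i.2)
    intro v x
    rw [← sesqForm_fromBlocks_elim_zero (κ := Fin (n - k)), ← hblocks, ← hTMT,
      sesqForm_conjTranspose_mul_mul, sesqForm_submatrix]
    exact re_eval_sesqForm_nonneg hM _ x
  have hTdet : IsCoprime T'.det (realPoly 𝕜 d) := by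
    obtain ⟨w, hw⟩ := ((Matrix.isUnit_iff_isUnit_det _).1 hT'u).exists_left_inv
    exact ⟨w, 0, by rw [hw]; ring⟩
  have h1 := (CongruentAwayFrom.of_conjTranspose_mul_mul hTdet (hTMT.trans hblocks)).trans
    (hM₀.fromBlocks_right 0)
  rw [← hDe] at h1
  simpa [M', Function.comp_assoc] using h1.submatrix e.symm

end diagonalForms

theorem mainTheorem7 {𝕜 : Type*} [RCLike 𝕜] {n : ℕ} (M : Matrix (Fin n) (Fin n) 𝕜[X])
    (hM : IsPosSemidefPoly M) :
    (∃! D : Matrix (Fin n) (Fin n) 𝕜[X], IsMonicSmithNormalForm M D) ∧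
      ∀ D : Matrix (Fin n) (Fin n) 𝕜[X], IsMonicSmithNormalForm M D →
        CongruentOver (localRingOf M) M D := by
  refine ⟨?_, fun D hD => ?_⟩
  · obtain ⟨D, hD⟩ := exists_isMonicSmithNormalForm M
    exact ⟨D, hD, fun D' hD' => isMonicSmithNormalForm_unique hD' hD⟩
  obtain ⟨a, rfl, ha1, ha0, hchain⟩ := hD.exists_realPoly hM.1
  obtain ⟨r, hr⟩ := exists_realPoly_eq (f := reducedDet M * star (reducedDet M))
    (by rw [star_mul, star_star])
  have hr0 : r ≠ 0 := by
    rw [Ne, ← realPoly_eq_zero (𝕜 := 𝕜), hr]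
    exact mul_ne_zero (reducedDet_ne_zero M) (star_ne_zero.2 (reducedDet_ne_zero M))
  -- a real multiple of `reducedDet M` and of all invariant factors; being divisible by `X`, it is
  -- coprime to nonzero polynomials only
  set p := ∏ i with (i : Fin n).val < M.rank, a i with hp
  set d := X * r * p with hd
  have hd0 : d ≠ 0 := mul_ne_zero (mul_ne_zero X_ne_zero hr0)
    (Finset.prod_ne_zero_iff.2 fun i hi => (ha1 i (Finset.mem_filter.1 hi).2).ne_zero)
  have hXd : X ∣ d := Dvd.intro _ (mul_assoc _ _ _).symm
  have hdu : ¬IsUnit d := fun h => not_isUnit_X (isUnit_of_dvd_unit hXd h)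
  have hcong := hD.congruentAwayFrom hM ha1 ha0 hchain hd0 hdu fun i hi =>
    (Finset.dvd_prod_of_mem a (Finset.mem_filter.2 ⟨Finset.mem_univ i, hi⟩)).trans
      (Dvd.intro_left _ rfl)
  refine hcong.symm.congruentOver fun b hb => ⟨?_, ?_⟩
  · rintro rfl
    have h0 : IsCoprime (0 : ℝ[X]) d := by
      rw [← isCoprime_realPoly_iff (𝕜 := 𝕜), map_zero]
      exact hb
    exact hdu (isCoprime_zero_left.1 h0)
  · refine hb.of_isCoprime_of_dvd_right ?_
    rw [hd, map_mul, map_mul, hr]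
    exact ((dvd_mul_right _ _).mul_left _).mul_right _
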